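/- Let $(M,g)$ and $(N,h)$ be smooth (finite-dimensional) Riemannian manifolds without boundary, let $\phi\colon M\to N$ be a smooth map, and let $X$ be a Killing vector field on $N$, that is, a smooth vector field with $\langle\nabla_YX,Z\rangle+\langle\nabla_ZX,Y\rangle=0$ for all tangent vectors $Y,Z$ at the same point of $N$. Write $\bar\nabla$ for the pull-back of the Levi-Civita connection of $N$ to $\phi^*TN$, $\tau=\tau(\phi)=\operatorname{Tr}_g\bar\nabla d\phi$ for the tension field, $\bar\Delta=-\operatorname{Tr}_g(\bar\nabla\bar\nabla-\bar\nabla_\nabla)$ for the rough Laplacian on $\phi^*TN$, and $R^N(X,Y)Z=[\nabla_X,\nabla_Y]Z-\nabla_{[X,Y]}Z$ for the curvature tensor of $N$; let $\{e_j\}$ denote an orthonormal basis of the tangent space of $M$ at the point under consideration, with summation over $j$. For an integer $s\ge 1$ set \begin{align*} \tau_{2s}(\phi):=\;&\bar\Delta^{2s-1}\tau-R^N(\bar\Delta^{2s-2}\tau,d\phi(e_j))d\phi(e_j)\\ &-\sum_{\ell=1}^{s-1}\Big(R^N(\bar\nabla_{e_j}\bar\Delta^{s+\ell-2}\tau,\bar\Delta^{s-\ell-1}\tau)d\phi(e_j)-R^N(\bar\Delta^{s+\ell-2}\tau,\bar\nabla_{e_j}\bar\Delta^{s-\ell-1}\tau)d\phi(e_j)\Big),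 \end{align*} and let $J^{2s}(\phi)$ be the vector field on $M$ determined by \begin{align*} \langle J^{2s}(\phi),v\rangle=\;&\langle\bar\nabla_v\bar\Delta^{2s-2}\tau,X\circ\phi\rangle-\langle\bar\nabla_v(X\circ\phi),\bar\Delta^{2s-2}\tau\rangle\\ &+\sum_{\ell=1}^{s-1}\Big(\big\langle(\nabla^N_{\bar\nabla_v\bar\Delta^{s+\ell-2}\tau}X)\circ\phi,\bar\Delta^{s-\ell-1}\tau\big\rangle+\big\langle(\nabla^N_{\bar\nabla_v\bar\Delta^{s-\ell-1}\tau}X)\circ\phi,\bar\Delta^{s+\ell-2}\tau\big\rangle\Big) \end{align*} for all tangent vectors $v$ of $M$. Then $J^{2s}(\phi)$ is a smooth vector field on $M$ and $$\operatorname{div}J^{2s}(\phi)=-\langle\tau_{2s}(\phi),X\circ\phi\rangle .$$ In particular, $J^{2s}(\phi)$ is divergence-free whenever $\phi$ is polyharmonic of order $2s$, that is, whenever $\tau_{2s}(\phi)=0$. -/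

import Mathlib

open scoped Manifold ContDiff Bundle
open Bundle

noncomputable section

namespace PolyharmonicMaps

/-! ## Riemannian geometry of one manifold

A Riemannian manifold without boundary is a manifold modelled on a finite-dimensional real vector
space, with inner products on the tangent spaces (`RiemannianBundle`) that depend smoothly on the
base point (`IsContMDiffRiemannianBundle`, assumed in the theorem). -/

section OneManifold

variable {E : Type*} [NormedAddCommGroup E] [NormedSpace ℝ E] [FiniteDimensional ℝ E]
  {M : Type*} [TopologicalSpace M] [ChartedSpace E M] [IsManifold 𝓘(ℝ, E) ∞ M]
  [RiemannianBundle (fun x : M => TangentSpace 𝓘(ℝ, E) x)]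

/-- Tangent spaces are finite-dimensional. -/
instance (x : M) : FiniteDimensional ℝ (TangentSpace 𝓘(ℝ, E) x) :=
  inferInstanceAs (FiniteDimensional ℝ E)

variable (E) in
/-- An orthonormal basis `e₁, …, eₘ` of the tangent space `T_x M`. -/
def frame (x : M) :
    OrthonormalBasis (Fin (Module.finrank ℝ (TangentSpace 𝓘(ℝ, E) x))) ℝ
      (TangentSpace 𝓘(ℝ, E) x) :=
  stdOrthonormalBasis ℝ (TangentSpace 𝓘(ℝ, E) x)

/-- The musical isomorphism `♯` at `x`: the vector `α^♯ ∈ T_x M` with `⟨α^♯, v⟩ = α(v)` for a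
linear form `α` on `T_x M`, written out as `∑ⱼ α(eⱼ) eⱼ`. -/
def sharp {x : M} (α : TangentSpace 𝓘(ℝ, E) x → ℝ) : TangentSpace 𝓘(ℝ, E) x :=
  ∑ j, α (frame E x j) • frame E x j

/-- The extension of `v ∈ T_x M` to a vector field near `x` whose components in the preferred
chart at `x` are constant (it takes the value `v` at `x`). -/
def constExt {x : M} (v : TangentSpace 𝓘(ℝ, E) x) : Π y : M, TangentSpace 𝓘(ℝ, E) y :=
  FiberBundle.extend E v

/-- The derivative `(U f)(x)` of a function `f` in the direction of a vector field `U`. -/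
def dirDeriv (U : Π y : M, TangentSpace 𝓘(ℝ, E) y) (f : M → ℝ) (x : M) : ℝ :=
  mvfderiv 𝓘(ℝ, E) f x (U x)

/-- The right-hand side of the Koszul formula, i.e. the value of `⟨∇_U V, W⟩` at `x`:
`½ (U⟨V,W⟩ + V⟨U,W⟩ - W⟨U,V⟩ + ⟨[U,V],W⟩ - ⟨[U,W],V⟩ - ⟨[V,W],U⟩)`. -/
def koszul (U V W : Π y : M, TangentSpace 𝓘(ℝ, E) y) (x : M) : ℝ :=
  (1 / 2 : ℝ) *
    (dirDeriv U (fun y => inner ℝ (V y) (W y)) x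
      + dirDeriv V (fun y => inner ℝ (U y) (W y)) x
      - dirDeriv W (fun y => inner ℝ (U y) (V y)) x
      + inner ℝ (VectorField.mlieBracket 𝓘(ℝ, E) U V x) (W x)
      - inner ℝ (VectorField.mlieBracket 𝓘(ℝ, E) U W x) (V x)
      - inner ℝ (VectorField.mlieBracket 𝓘(ℝ, E) V W x) (U x))

/-- The Levi-Civita connection: `nabla V x u = ∇_u V ∈ T_x M` for a vector field `V` and
`u ∈ T_x M`, defined by the Koszul formula. -/
def nabla (V : Π y : M, TangentSpace 𝓘(ℝ, E) y) (x : M) (u : TangentSpace 𝓘(ℝ, E) x) :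
    TangentSpace 𝓘(ℝ, E) x :=
  sharp fun w => koszul (constExt u) V (constExt w) x

/-- The divergence `div V = ∑ⱼ ⟨∇_{eⱼ} V, eⱼ⟩` of a vector field. -/
def divergence (V : Π y : M, TangentSpace 𝓘(ℝ, E) y) (x : M) : ℝ :=
  ∑ j, inner ℝ (nabla V x (frame E x j)) (frame E x j)

/-- The curvature tensor `R(u, v) w` at `x`, from
`R(U,V)W = ∇_U ∇_V W - ∇_V ∇_U W - ∇_{[U,V]} W`, evaluated on extensions of `u`, `v`, `w`. -/
def curvature {x : M} (u v w : TangentSpace 𝓘(ℝ, E) x) : TangentSpace 𝓘(ℝ, E) x :=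
  nabla (fun y => nabla (constExt w) y (constExt v y)) x u
    - nabla (fun y => nabla (constExt w) y (constExt u y)) x v
    - nabla (constExt w) x (VectorField.mlieBracket 𝓘(ℝ, E) (constExt u) (constExt v) x)

/-- Smoothness of a vector field. -/
def IsSmoothField (V : Π y : M, TangentSpace 𝓘(ℝ, E) y) : Prop :=
  ContMDiff 𝓘(ℝ, E) 𝓘(ℝ, E).tangent ∞ (fun y => (⟨y, V y⟩ : TangentBundle 𝓘(ℝ, E) M))

/-- A Killing vector field: a smooth vector field `X` with `ℒ_X h = 0`, where
`(ℒ_X h)(v, w) = ⟨∇_v X, w⟩ + ⟨∇_w X, v⟩`. -/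
def IsKilling (X : Π y : M, TangentSpace 𝓘(ℝ, E) y) : Prop :=
  IsSmoothField X ∧ ∀ (y : M) (v w : TangentSpace 𝓘(ℝ, E) y),
    inner ℝ (nabla X y v) w + inner ℝ (nabla X y w) v = 0

end OneManifold

/-! ## Vector fields along a map `φ : M → N`, i.e. sections of `φ^* TN` -/

section AlongMap

variable {E : Type*} [NormedAddCommGroup E] [NormedSpace ℝ E] [FiniteDimensional ℝ E]
  {M : Type*} [TopologicalSpace M] [ChartedSpace E M] [IsManifold 𝓘(ℝ, E) ∞ M]
  [RiemannianBundle (fun x : M => TangentSpace 𝓘(ℝ, E) x)]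
  {F : Type*} [NormedAddCommGroup F] [NormedSpace ℝ F] [FiniteDimensional ℝ F]
  {N : Type*} [TopologicalSpace N] [ChartedSpace F N] [IsManifold 𝓘(ℝ, F) ∞ N]
  [RiemannianBundle (fun y : N => TangentSpace 𝓘(ℝ, F) y)]

variable (E F) in
/-- The differential `dφ_x : T_x M → T_{φ x} N`. -/
def dmap (φ : M → N) (x : M) (v : TangentSpace 𝓘(ℝ, E) x) : TangentSpace 𝓘(ℝ, F) (φ x) :=
  mfderiv 𝓘(ℝ, E) 𝓘(ℝ, F) φ x v

variable (E F) in
/-- The pull-back connection `∇̄_v V` at `x` of a vector field `V` along `φ`: writing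
`V = ∑ₐ Vᵃ (Eₐ ∘ φ)` near `x` in the coordinate frame `Eₐ` of the preferred chart of `N` at `φ x`,
this is `∇̄_v V = ∑ₐ (dVᵃ(v) Eₐ + Vᵃ ∇^N_{dφ(v)} Eₐ)`. -/
def covAlong (φ : M → N) (V : Π y : M, TangentSpace 𝓘(ℝ, F) (φ y)) (x : M)
    (v : TangentSpace 𝓘(ℝ, E) x) : TangentSpace 𝓘(ℝ, F) (φ x) :=
  (trivializationAt F (TangentSpace 𝓘(ℝ, F) (M := N)) (φ x)).symm (φ x)
      (mvfderiv 𝓘(ℝ, E) (fun y => (trivializationAt F (TangentSpace 𝓘(ℝ, F) (M := N)) (φ x)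
        (⟨φ y, V y⟩ : TangentBundle 𝓘(ℝ, F) N)).2) x v)
    + nabla (constExt (V x)) (φ x) (dmap E F φ x v)

variable (E F) in
/-- The tension field `τ(φ) = Tr_g ∇̄dφ`, where `(∇̄dφ)(U, W) = ∇̄_U (dφ(W)) - dφ(∇_U W)`. -/
def tension (φ : M → N) (x : M) : TangentSpace 𝓘(ℝ, F) (φ x) :=
  ∑ j, (covAlong E F φ (fun y => dmap E F φ y (constExt (frame E x j) y)) x (frame E x j)
    - dmap E F φ x (nabla (constExt (frame E x j)) x (frame E x j)))

variable (E F) in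
/-- The rough Laplacian on `φ^* TN`, with the sign `Δ̄ = - Tr_g (∇̄∇̄ - ∇̄_∇)`. -/
def roughLaplacian (φ : M → N) (V : Π y : M, TangentSpace 𝓘(ℝ, F) (φ y)) (x : M) :
    TangentSpace 𝓘(ℝ, F) (φ x) :=
  -∑ j, (covAlong E F φ (fun y => covAlong E F φ V y (constExt (frame E x j) y)) x (frame E x j)
    - covAlong E F φ V x (nabla (constExt (frame E x j)) x (frame E x j)))

variable (E F) in
/-- The iterated rough Laplacian `Δ̄ᵏ τ(φ)` of the tension field. -/
def lapTension (φ : M → N) (k : ℕ) : Π x : M, TangentSpace 𝓘(ℝ, F) (φ x) :=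
  (roughLaplacian E F φ)^[k] (tension E F φ)

variable (E F) in
/-- The field
`τ_{2s}(φ) = Δ̄^{2s-1} τ - ∑ⱼ R^N(Δ̄^{2s-2} τ, dφ(eⱼ)) dφ(eⱼ)
  - ∑_{ℓ=1}^{s-1} ∑ⱼ (R^N(∇̄_{eⱼ} Δ̄^{s+ℓ-2} τ, Δ̄^{s-ℓ-1} τ) dφ(eⱼ)
      - R^N(Δ̄^{s+ℓ-2} τ, ∇̄_{eⱼ} Δ̄^{s-ℓ-1} τ) dφ(eⱼ))`, for `s ≥ 1`. -/
def tauEven (s : ℕ) (φ : M → N) (x : M) : TangentSpace 𝓘(ℝ, F) (φ x) :=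
  lapTension E F φ (2 * s - 1) x
    - ∑ j, curvature (lapTension E F φ (2 * s - 2) x) (dmap E F φ x (frame E x j))
        (dmap E F φ x (frame E x j))
    - ∑ l ∈ Finset.Icc 1 (s - 1), ∑ j,
        (curvature (covAlong E F φ (lapTension E F φ (s + l - 2)) x (frame E x j))
            (lapTension E F φ (s - l - 1) x) (dmap E F φ x (frame E x j))
          - curvature (lapTension E F φ (s + l - 2) x)
            (covAlong E F φ (lapTension E F φ (s - l - 1)) x (frame E x j))
            (dmap E F φ x (frame E x j)))

variable (E F) in
/-- `φ` is polyharmonic of order `2s`: it solves `τ_{2s}(φ) = 0`. -/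
def IsPolyharmonicEven (s : ℕ) (φ : M → N) : Prop :=
  ∀ x : M, tauEven E F s φ x = 0

variable (E F) in
/-- The one-form
`v ↦ ⟨∇̄_v Δ̄^{2s-2} τ, X∘φ⟩ - ⟨∇̄_v (X∘φ), Δ̄^{2s-2} τ⟩
  + ∑_{ℓ=1}^{s-1} (⟨∇^N_{∇̄_v Δ̄^{s+ℓ-2} τ} X, Δ̄^{s-ℓ-1} τ⟩
      + ⟨∇^N_{∇̄_v Δ̄^{s-ℓ-1} τ} X, Δ̄^{s+ℓ-2} τ⟩)`. -/
def currentFormEven (s : ℕ) (φ : M → N) (X : Π y : N, TangentSpace 𝓘(ℝ, F) y) (x : M)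
    (v : TangentSpace 𝓘(ℝ, E) x) : ℝ :=
  inner ℝ (covAlong E F φ (lapTension E F φ (2 * s - 2)) x v) (X (φ x))
    - inner ℝ (covAlong E F φ (fun y => X (φ y)) x v) (lapTension E F φ (2 * s - 2) x)
    + ∑ l ∈ Finset.Icc 1 (s - 1),
        (inner ℝ (nabla X (φ x) (covAlong E F φ (lapTension E F φ (s + l - 2)) x v))
            (lapTension E F φ (s - l - 1) x)
          + inner ℝ (nabla X (φ x) (covAlong E F φ (lapTension E F φ (s - l - 1)) x v))
            (lapTension E F φ (s + l - 2) x))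

variable (E F) in
/-- The current `J^{2s}(φ)`, the vector field on `M` dual to `currentFormEven s φ X`. -/
def currentEven (s : ℕ) (φ : M → N) (X : Π y : N, TangentSpace 𝓘(ℝ, F) y) (x : M) :
    TangentSpace 𝓘(ℝ, E) x :=
  sharp (currentFormEven E F s φ X x)

end AlongMap

end PolyharmonicMaps

end

/-! Write σ_k for Δ̄ᵏτ and n = s - 1. Because X is Killing, ∇X is skew-symmetric. The current is
therefore a signed sum of one-forms v ↦ ⟨∇̄_v A, B⟩, each with divergence -⟨Δ̄A, B⟩ + ⟨∇̄A, ∇̄B⟩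
(`divForm_pairForm`).

In the first two terms of the current the gradient products cancel, leaving -⟨σ_{2n+1}, X⟩ +
⟨Δ̄(X∘φ), σ_{2n}⟩. Kostant's identity ⟨∇²_{u,v}X, w⟩ = ⟨R(v,w)u, X⟩ (`inner_nabla_nabla_killing`)
evaluates Δ̄(X∘φ) (`inner_roughLaplacian_killing`). This gives the curvature term of τ_{2s} in
σ_{2n}, together with an unwanted -⟨∇_τ X, σ_{2n}⟩.

The sum over ℓ removes that remainder. Put t(i,j) = ⟨σ_i, ∇_{σ_j}X⟩, which is antisymmetric. The
ℓ-th summand has divergence t(n+ℓ, n-ℓ) - t(n+ℓ-1, n-ℓ+1) plus the ℓ-th curvature terms of τ_{2s}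
(`divForm_pairForm_nabla_killing`). The t-part telescopes from t(n,n) = 0 to t(2n,0) = ⟨σ_{2n}, ∇_τ
X⟩ (`sum_telescope`).

The remaining work is foundational, since the connections are given by explicit formulas at each
point. Two devices carry it. A defect that is linear over functions vanishes once it vanishes on
coordinate fields (`TensorialAlongAt.eq_constExt`). Traces over orthonormal bases chosen point by
point are rewritten in a smooth frame and its dual (`sum_frame_eq_sum_dualFrame`). -/

noncomputable section

namespace PolyharmonicMaps

open scoped Topology
open Filter

set_option linter.unusedSectionVars false

/-! ### The Levi-Civita connection from the Koszul formula. -/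

section OneManifold

variable {E : Type*} [NormedAddCommGroup E] [NormedSpace ℝ E] [FiniteDimensional ℝ E]
  {M : Type*} [TopologicalSpace M] [ChartedSpace E M] [IsManifold 𝓘(ℝ, E) ∞ M]
  [RiemannianBundle (fun x : M => TangentSpace 𝓘(ℝ, E) x)]

/-- Smoothness of a vector field at a point. -/
abbrev SmoothFieldAt (V : Π y : M, TangentSpace 𝓘(ℝ, E) y) (x : M) : Prop :=
  ContMDiffAt 𝓘(ℝ, E) 𝓘(ℝ, E).tangent ∞ (fun y => (⟨y, V y⟩ : TangentBundle 𝓘(ℝ, E) M)) x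

/-- Differentiability of a vector field at a point. -/
abbrev DiffFieldAt (V : Π y : M, TangentSpace 𝓘(ℝ, E) y) (x : M) : Prop :=
  MDifferentiableAt 𝓘(ℝ, E) 𝓘(ℝ, E).tangent (fun y => (⟨y, V y⟩ : TangentBundle 𝓘(ℝ, E) M)) x

theorem SmoothFieldAt.diff {V : Π y : M, TangentSpace 𝓘(ℝ, E) y} {x : M} (hV : SmoothFieldAt V x) :
    DiffFieldAt V x :=
  ContMDiffAt.mdifferentiableAt hV (by simp)

theorem smoothFieldAt_constExt {x : M} (v : TangentSpace 𝓘(ℝ, E) x) :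
    SmoothFieldAt (constExt v) x :=
  FiberBundle.contMDiffAt_extend 𝓘(ℝ, E) E (V := fun x : M => TangentSpace 𝓘(ℝ, E) x) v

theorem diffFieldAt_constExt {x : M} (v : TangentSpace 𝓘(ℝ, E) x) : DiffFieldAt (constExt v) x :=
  (smoothFieldAt_constExt v).diff

@[simp]
theorem constExt_self {x : M} (v : TangentSpace 𝓘(ℝ, E) x) : constExt v x = v :=
  FiberBundle.extend_apply_self E (E := fun x : M => TangentSpace 𝓘(ℝ, E) x) v

section Derivation

variable (U : Π y : M, TangentSpace 𝓘(ℝ, E) y) {f g : M → ℝ} {x : M}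

theorem dirDeriv_mul (hf : MDifferentiableAt 𝓘(ℝ, E) 𝓘(ℝ) f x)
    (hg : MDifferentiableAt 𝓘(ℝ, E) 𝓘(ℝ) g x) :
    dirDeriv U (fun y => f y * g y) x = f x * dirDeriv U g x + g x * dirDeriv U f x := by
  simp only [dirDeriv]
  rw [mvfderiv_fun_mul hf hg]
  simp

theorem dirDeriv_add (hf : MDifferentiableAt 𝓘(ℝ, E) 𝓘(ℝ) f x)
    (hg : MDifferentiableAt 𝓘(ℝ, E) 𝓘(ℝ) g x) :
    dirDeriv U (fun y => f y + g y) x = dirDeriv U f x + dirDeriv U g x := by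
  simp only [dirDeriv]
  rw [mvfderiv_fun_add hf hg]
  simp

theorem mvfderiv_congr {G : Type*} [NormedAddCommGroup G] [NormedSpace ℝ G] {f g : M → G}
    (h : f =ᶠ[𝓝 x] g) : mvfderiv 𝓘(ℝ, E) f x = mvfderiv 𝓘(ℝ, E) g x := by
  simp only [mvfderiv]
  rw [Filter.EventuallyEq.mfderiv_eq h]
  congr 1

theorem dirDeriv_congr (h : f =ᶠ[𝓝 x] g) : dirDeriv U f x = dirDeriv U g x := by
  simp only [dirDeriv]
  rw [mvfderiv_congr h]

end Derivation

section Koszul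

variable [IsContMDiffRiemannianBundle 𝓘(ℝ, E) ∞ E (fun x : M => TangentSpace 𝓘(ℝ, E) x)]
  {U V W U' V' W' : Π y : M, TangentSpace 𝓘(ℝ, E) y} {f : M → ℝ} {x : M}

theorem DiffFieldAt.inner_field (hV : DiffFieldAt V x) (hW : DiffFieldAt W x) :
    MDifferentiableAt 𝓘(ℝ, E) 𝓘(ℝ) (fun y => (inner ℝ (V y) (W y) : ℝ)) x :=
  MDifferentiableAt.inner_bundle (F := E) (E := fun x : M => TangentSpace 𝓘(ℝ, E) x)
    (b := fun y => y) hV hW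

theorem DiffFieldAt.add (hV : DiffFieldAt V x) (hW : DiffFieldAt W x) : DiffFieldAt (V + W) x :=
  mdifferentiableAt_add_section (F := E) (E := fun x : M => TangentSpace 𝓘(ℝ, E) x) hV hW

theorem DiffFieldAt.smul (hf : MDifferentiableAt 𝓘(ℝ, E) 𝓘(ℝ) f x) (hW : DiffFieldAt W x) :
    DiffFieldAt (f • W) x :=
  MDifferentiableAt.smul_section (F := E) (E := fun x : M => TangentSpace 𝓘(ℝ, E) x) hf hW

theorem dirDeriv_inner_add_right (hV : DiffFieldAt V x) (hW : DiffFieldAt W x)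
    (hW' : DiffFieldAt W' x) :
    dirDeriv U (fun y => inner ℝ (V y) ((W + W') y)) x =
      dirDeriv U (fun y => inner ℝ (V y) (W y)) x
        + dirDeriv U (fun y => inner ℝ (V y) (W' y)) x := by
  simp only [Pi.add_apply, inner_add_right]
  exact dirDeriv_add _ (hV.inner_field hW) (hV.inner_field hW')

theorem dirDeriv_inner_smul_right (hf : MDifferentiableAt 𝓘(ℝ, E) 𝓘(ℝ) f x)
    (hV : DiffFieldAt V x) (hW : DiffFieldAt W x) :
    dirDeriv U (fun y => inner ℝ (V y) ((f • W) y)) x =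
      f x * dirDeriv U (fun y => inner ℝ (V y) (W y)) x
        + inner ℝ (V x) (W x) * dirDeriv U f x := by
  simp only [Pi.smul_apply', inner_smul_right]
  exact dirDeriv_mul _ hf (hV.inner_field hW)

theorem dirDeriv_inner_comm (U V W : Π y : M, TangentSpace 𝓘(ℝ, E) y) :
    dirDeriv U (fun y => inner ℝ (V y) (W y)) x = dirDeriv U (fun y => inner ℝ (W y) (V y)) x := by
  simp only [real_inner_comm]

/-- The derivatives of `f` coming from the metric terms cancel against those coming from the
brackets. -/
theorem koszul_smul_right (hf : MDifferentiableAt 𝓘(ℝ, E) 𝓘(ℝ) f x) (hU : DiffFieldAt U x)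
    (hV : DiffFieldAt V x) (hW : DiffFieldAt W x) :
    koszul U V (f • W) x = f x * koszul U V W x := by
  simp only [koszul]
  rw [VectorField.mlieBracket_smul_right hf hW, VectorField.mlieBracket_smul_right hf hW,
    dirDeriv_inner_smul_right hf hV hW, dirDeriv_inner_smul_right hf hU hW]
  simp only [dirDeriv, Pi.smul_apply', map_smul, inner_smul_right, inner_add_left,
    inner_smul_left, smul_eq_mul, conj_trivial]
  rw [real_inner_comm (W x) (V x), real_inner_comm (U x) (W x)]
  ring

theorem koszul_add_right (hU : DiffFieldAt U x)
    (hV : DiffFieldAt V x) (hW : DiffFieldAt W x) (hW' : DiffFieldAt W' x) :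
    koszul U V (W + W') x = koszul U V W x + koszul U V W' x := by
  simp only [koszul]
  rw [VectorField.mlieBracket_add_right hW hW', VectorField.mlieBracket_add_right hW hW',
    dirDeriv_inner_add_right hV hW hW', dirDeriv_inner_add_right hU hW hW']
  simp only [dirDeriv, Pi.add_apply, map_add, inner_add_left, inner_add_right]
  ring

/-- Here the terms in `W f` cancel, while the two terms in `U f` add up and absorb the factor 1/2:
this is the Leibniz rule. -/
theorem koszul_smul_middle (hf : MDifferentiableAt 𝓘(ℝ, E) 𝓘(ℝ) f x) (hU : DiffFieldAt U x)
    (hV : DiffFieldAt V x) (hW : DiffFieldAt W x) :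
    koszul U (f • V) W x
      = f x * koszul U V W x + mvfderiv 𝓘(ℝ, E) f x (U x) * inner ℝ (V x) (W x) := by
  simp only [koszul]
  rw [VectorField.mlieBracket_smul_right hf hV, VectorField.mlieBracket_smul_left hf hV,
    dirDeriv_inner_comm U (f • V), dirDeriv_inner_comm U V,
    dirDeriv_inner_smul_right hf hW hV, dirDeriv_inner_smul_right hf hU hV]
  simp only [dirDeriv, Pi.smul_apply', map_smul, inner_smul_right, inner_add_left,
    inner_smul_left, smul_eq_mul, conj_trivial]
  rw [real_inner_comm (W x) (V x), real_inner_comm (U x) (V x)]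
  ring

theorem koszul_add_middle (hU : DiffFieldAt U x)
    (hV : DiffFieldAt V x) (hV' : DiffFieldAt V' x) (hW : DiffFieldAt W x) :
    koszul U (V + V') W x = koszul U V W x + koszul U V' W x := by
  simp only [koszul]
  rw [VectorField.mlieBracket_add_right hV hV', VectorField.mlieBracket_add_left hV hV',
    dirDeriv_inner_comm U (V + V'), dirDeriv_inner_comm U V, dirDeriv_inner_comm U V',
    dirDeriv_inner_add_right hW hV hV', dirDeriv_inner_add_right hU hV hV']
  simp only [dirDeriv, Pi.add_apply, map_add, inner_add_left, inner_add_right]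
  ring

theorem koszul_smul_left (hf : MDifferentiableAt 𝓘(ℝ, E) 𝓘(ℝ) f x) (hU : DiffFieldAt U x)
    (hV : DiffFieldAt V x) (hW : DiffFieldAt W x) :
    koszul (f • U) V W x = f x * koszul U V W x := by
  simp only [koszul]
  rw [VectorField.mlieBracket_smul_left hf hU, VectorField.mlieBracket_smul_left hf hU,
    dirDeriv_inner_comm V (f • U), dirDeriv_inner_comm W (f • U), dirDeriv_inner_comm V U,
    dirDeriv_inner_comm W U,
    dirDeriv_inner_smul_right hf hW hU, dirDeriv_inner_smul_right hf hV hU]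
  simp only [dirDeriv, Pi.smul_apply', map_smul, inner_smul_right, inner_add_left,
    inner_smul_left, smul_eq_mul, conj_trivial]
  rw [real_inner_comm (W x) (U x), real_inner_comm (U x) (V x)]
  ring

theorem koszul_add_left (hU : DiffFieldAt U x) (hU' : DiffFieldAt U' x)
    (hV : DiffFieldAt V x) (hW : DiffFieldAt W x) :
    koszul (U + U') V W x = koszul U V W x + koszul U' V W x := by
  simp only [koszul]
  rw [VectorField.mlieBracket_add_left hU hU', VectorField.mlieBracket_add_left hU hU',
    dirDeriv_inner_comm V (U + U'), dirDeriv_inner_comm W (U + U'), dirDeriv_inner_comm V U,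
    dirDeriv_inner_comm W U, dirDeriv_inner_comm V U', dirDeriv_inner_comm W U',
    dirDeriv_inner_add_right hW hU hU', dirDeriv_inner_add_right hV hU hU']
  simp only [dirDeriv, Pi.add_apply, map_add, inner_add_left, inner_add_right]
  ring

theorem koszul_congr_middle (h : V =ᶠ[𝓝 x] V') : koszul U V W x = koszul U V' W x := by
  simp only [koszul]
  rw [h.self_of_nhds, Filter.EventuallyEq.mlieBracket_vectorField_eq (EventuallyEq.refl _ U) h,
    Filter.EventuallyEq.mlieBracket_vectorField_eq h (EventuallyEq.refl _ W),
    dirDeriv_congr U (f := fun y => inner ℝ (V y) (W y)) (g := fun y => inner ℝ (V' y) (W y))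
      (h.mono fun y hy => by simp only [hy]),
    dirDeriv_congr W (f := fun y => inner ℝ (U y) (V y)) (g := fun y => inner ℝ (U y) (V' y))
      (h.mono fun y hy => by simp only [hy])]
  simp only [dirDeriv, h.self_of_nhds]

theorem tensorial_koszul_right (hU : DiffFieldAt U x) (hV : DiffFieldAt V x) :
    TensorialAt 𝓘(ℝ, E) E (V := fun y : M => TangentSpace 𝓘(ℝ, E) y)
      (fun W => koszul U V W x) x where
  smul hf hW := koszul_smul_right hf hU hV hW
  add hW hW' := koszul_add_right hU hV hW hW'

theorem tensorial_koszul_left (hV : DiffFieldAt V x) (hW : DiffFieldAt W x) :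
    TensorialAt 𝓘(ℝ, E) E (V := fun y : M => TangentSpace 𝓘(ℝ, E) y)
      (fun U => koszul U V W x) x where
  smul hf hU := koszul_smul_left hf hU hV hW
  add hU hU' := koszul_add_left hU hU' hV hW

theorem koszul_pointwise (hU : DiffFieldAt U x) (hU' : DiffFieldAt U' x) (hV : DiffFieldAt V x)
    (hW : DiffFieldAt W x) (hW' : DiffFieldAt W' x) (h : U x = U' x) (h' : W x = W' x) :
    koszul U V W x = koszul U' V W' x :=
  ((tensorial_koszul_left hV hW).pointwise hU hU' h).trans
    ((tensorial_koszul_right hU' hV).pointwise hW hW' h')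

theorem inner_sharp {α : TangentSpace 𝓘(ℝ, E) x → ℝ} (hα : IsLinearMap ℝ α)
    (w : TangentSpace 𝓘(ℝ, E) x) : inner ℝ (sharp α) w = α w := by
  conv_rhs => rw [← (frame E x).sum_repr' w]
  have h := map_sum (hα.mk' α) (fun j => inner ℝ (frame E x j) w • frame E x j) Finset.univ
  simp only [IsLinearMap.mk'_apply] at h
  rw [h, sharp, sum_inner]
  refine Finset.sum_congr rfl fun j _ => ?_
  rw [inner_smul_left, hα.map_smul, smul_eq_mul]
  simp [mul_comm]

/-- Tensoriality in the outer slots frees the definition of `nabla` from its chart-dependent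
extensions: any differentiable fields with the right values at `x` may be used. -/
theorem inner_nabla (hU : DiffFieldAt U x) (hV : DiffFieldAt V x) (hW : DiffFieldAt W x) :
    inner ℝ (nabla V x (U x)) (W x) = koszul U V W x := by
  rw [nabla, inner_sharp]
  · exact koszul_pointwise (diffFieldAt_constExt _) hU hV (diffFieldAt_constExt _) hW
      (constExt_self _) (constExt_self _)
  · have hK := tensorial_koszul_right (diffFieldAt_constExt (U x)) hV
    exact ⟨fun v w => (TensorialAt.mkHom _ x hK).map_add v w,
      fun c v => (TensorialAt.mkHom _ x hK).map_smul c v⟩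

theorem inner_nabla' (hV : DiffFieldAt V x) (u w : TangentSpace 𝓘(ℝ, E) x) :
    inner ℝ (nabla V x u) w = koszul (constExt u) V (constExt w) x := by
  simpa using inner_nabla (diffFieldAt_constExt u) hV (diffFieldAt_constExt w)

theorem nabla_map_add (hV : DiffFieldAt V x) (u u' : TangentSpace 𝓘(ℝ, E) x) :
    nabla V x (u + u') = nabla V x u + nabla V x u' := by
  refine ext_inner_right ℝ fun w => ?_
  rw [inner_add_left, inner_nabla' hV, inner_nabla' hV, inner_nabla' hV]
  have hK := tensorial_koszul_left hV (diffFieldAt_constExt w)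
  exact (TensorialAt.mkHom _ x hK).map_add u u'

theorem nabla_map_smul (hV : DiffFieldAt V x) (c : ℝ) (u : TangentSpace 𝓘(ℝ, E) x) :
    nabla V x (c • u) = c • nabla V x u := by
  refine ext_inner_right ℝ fun w => ?_
  rw [inner_smul_left, inner_nabla' hV, inner_nabla' hV]
  have hK := tensorial_koszul_left hV (diffFieldAt_constExt w)
  exact (TensorialAt.mkHom _ x hK).map_smul c u

theorem isLinearMap_nabla (hV : DiffFieldAt V x) : IsLinearMap ℝ (nabla V x) :=
  ⟨nabla_map_add hV, nabla_map_smul hV⟩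

theorem nabla_add (hV : DiffFieldAt V x) (hV' : DiffFieldAt V' x) (u : TangentSpace 𝓘(ℝ, E) x) :
    nabla (V + V') x u = nabla V x u + nabla V' x u := by
  refine ext_inner_right ℝ fun w => ?_
  rw [inner_add_left, inner_nabla' hV, inner_nabla' hV', inner_nabla' (hV.add hV')]
  exact koszul_add_middle (diffFieldAt_constExt u) hV hV' (diffFieldAt_constExt w)

theorem nabla_smul (hf : MDifferentiableAt 𝓘(ℝ, E) 𝓘(ℝ) f x) (hV : DiffFieldAt V x)
    (u : TangentSpace 𝓘(ℝ, E) x) :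
    nabla (f • V) x u = f x • nabla V x u + mvfderiv 𝓘(ℝ, E) f x u • V x := by
  refine ext_inner_right ℝ fun w => ?_
  rw [inner_add_left, inner_smul_left, inner_smul_left, inner_nabla' hV,
    inner_nabla' (DiffFieldAt.smul hf hV),
    koszul_smul_middle hf (diffFieldAt_constExt u) hV (diffFieldAt_constExt w)]
  simp

theorem nabla_congr (h : V =ᶠ[𝓝 x] V') (u : TangentSpace 𝓘(ℝ, E) x) :
    nabla V x u = nabla V' x u := by
  simp only [nabla, koszul_congr_middle h]

/-- Metric compatibility of the Levi-Civita connection. -/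
theorem mvfderiv_inner (hV : DiffFieldAt V x) (hW : DiffFieldAt W x)
    (u : TangentSpace 𝓘(ℝ, E) x) :
    mvfderiv 𝓘(ℝ, E) (fun y => (inner ℝ (V y) (W y) : ℝ)) x u
      = inner ℝ (nabla V x u) (W x) + inner ℝ (V x) (nabla W x u) := by
  have hu := diffFieldAt_constExt u
  have h1 := inner_nabla hu hV hW
  have h2 := inner_nabla hu hW hV
  rw [constExt_self] at h1 h2
  rw [real_inner_comm _ (V x), h1, h2]
  simp only [koszul]
  rw [dirDeriv_inner_comm _ W V, VectorField.mlieBracket_swap_apply (V := W) (W := V)]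
  simp only [dirDeriv, constExt_self, inner_neg_left]
  ring

/-- The Levi-Civita connection is torsion-free. -/
theorem nabla_sub_nabla (hU : DiffFieldAt U x) (hV : DiffFieldAt V x) :
    nabla V x (U x) - nabla U x (V x) = VectorField.mlieBracket 𝓘(ℝ, E) U V x := by
  refine ext_inner_right ℝ fun w => ?_
  have hw := diffFieldAt_constExt w
  have h1 := inner_nabla hU hV hw
  have h2 := inner_nabla hV hU hw
  rw [constExt_self] at h1 h2
  rw [inner_sub_left, h1, h2]
  simp only [koszul]
  rw [dirDeriv_inner_comm _ V U, VectorField.mlieBracket_swap_apply (V := V) (W := U)]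
  simp only [constExt_self, inner_neg_left]
  ring

end Koszul

end OneManifold

/-! ### Coordinate frames and second derivatives of functions. -/

section OneManifold

variable {E : Type*} [NormedAddCommGroup E] [NormedSpace ℝ E] [FiniteDimensional ℝ E]
  {M : Type*} [TopologicalSpace M] [ChartedSpace E M] [IsManifold 𝓘(ℝ, E) ∞ M]
  [RiemannianBundle (fun x : M => TangentSpace 𝓘(ℝ, E) x)]

variable (E) in
/-- The preferred trivialization of the tangent bundle at a point. -/
abbrev tangentTriv (x : M) : Trivialization E (π E (TangentSpace 𝓘(ℝ, E) (M := M))) :=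
  trivializationAt E (TangentSpace 𝓘(ℝ, E) (M := M)) x

theorem mem_tangentTriv_baseSet (x : M) : x ∈ (tangentTriv E x).baseSet :=
  FiberBundle.mem_baseSet_trivializationAt' x

theorem eventually_mem_tangentTriv_baseSet (x : M) : ∀ᶠ y in 𝓝 x, y ∈ (tangentTriv E x).baseSet :=
  (tangentTriv E x).open_baseSet.mem_nhds (mem_tangentTriv_baseSet x)

theorem constExt_eq_symm {x : M} (v : TangentSpace 𝓘(ℝ, E) x) (y : M) :
    constExt v y = (tangentTriv E x).symm y ((tangentTriv E x) ⟨x, v⟩).2 := rfl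

theorem isLinearMap_tangentTriv {x y : M} (hy : y ∈ (tangentTriv E x).baseSet) :
    IsLinearMap ℝ (fun v : TangentSpace 𝓘(ℝ, E) y => ((tangentTriv E x) ⟨y, v⟩).2) :=
  (tangentTriv E x).linear ℝ hy

theorem isLinearMap_tangentTriv_symm {x y : M} (hy : y ∈ (tangentTriv E x).baseSet) :
    IsLinearMap ℝ (fun w : E => (tangentTriv E x).symm y w) := by
  have h := ((tangentTriv E x).symmₗ ℝ y).isLinear
  rwa [Trivialization.coe_symmₗ _ hy] at h

theorem isLinearMap_constExt {x y : M} (hy : y ∈ (tangentTriv E x).baseSet) :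
    IsLinearMap ℝ (fun v : TangentSpace 𝓘(ℝ, E) x => constExt v y) := by
  have h1 := isLinearMap_tangentTriv (mem_tangentTriv_baseSet (E := E) x)
  have h2 := isLinearMap_tangentTriv_symm hy
  exact ⟨fun v w => by simp only [constExt_eq_symm, h1.map_add, h2.map_add],
    fun c v => by simp only [constExt_eq_symm, h1.map_smul, h2.map_smul]⟩

theorem constExt_symm {x y : M} (w : E) :
    constExt ((tangentTriv E x).symm x w) y = (tangentTriv E x).symm y w := by
  rw [constExt_eq_symm, Trivialization.apply_mk_symm _ (mem_tangentTriv_baseSet x)]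

/-- The `i`-th component of `v ∈ T_y M` in the coordinate frame near `x` that extends the
orthonormal basis `frame x`. -/
def frameCoeff (x : M) (i : Fin (Module.finrank ℝ (TangentSpace 𝓘(ℝ, E) x))) (y : M)
    (v : TangentSpace 𝓘(ℝ, E) y) : ℝ :=
  inner ℝ (frame E x i) ((tangentTriv E x).symm x ((tangentTriv E x) ⟨y, v⟩).2)

theorem isLinearMap_frameCoeff {x y : M} (hy : y ∈ (tangentTriv E x).baseSet)
    (i : Fin (Module.finrank ℝ (TangentSpace 𝓘(ℝ, E) x))) :
    IsLinearMap ℝ (frameCoeff x i y) := by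
  have h1 := isLinearMap_tangentTriv hy
  have h2 := isLinearMap_tangentTriv_symm (mem_tangentTriv_baseSet (E := E) x)
  exact ⟨fun v w => by simp only [frameCoeff, h1.map_add, h2.map_add, inner_add_right],
    fun c v => by
      simp only [frameCoeff, h1.map_smul, h2.map_smul, inner_smul_right, smul_eq_mul]⟩

theorem sum_frameCoeff_smul {x y : M} (hy : y ∈ (tangentTriv E x).baseSet)
    (v : TangentSpace 𝓘(ℝ, E) y) :
    ∑ i, frameCoeff x i y v • constExt (frame E x i) y = v := by
  have h := isLinearMap_constExt hy
  have h3 := map_sum (h.mk' _)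
    (fun i => frameCoeff x i y v • frame E x i) Finset.univ
  simp only [IsLinearMap.mk'_apply, h.map_smul] at h3
  rw [← h3]
  simp only [frameCoeff]
  rw [(frame E x).sum_repr', constExt_symm, Trivialization.symm_apply_apply_mk _ hy]

theorem tangentTriv_constExt {x y : M} (hy : y ∈ (tangentTriv E x).baseSet)
    (v : TangentSpace 𝓘(ℝ, E) x) :
    ((tangentTriv E x) ⟨y, constExt v y⟩).2 = ((tangentTriv E x) ⟨x, v⟩).2 := by
  rw [constExt_eq_symm, Trivialization.apply_mk_symm _ hy]

theorem continuousLinearEquivAt_eq_mfderiv {x y : M} (hy : y ∈ (tangentTriv E x).baseSet) :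
    (((tangentTriv E x).continuousLinearEquivAt ℝ y hy) :
      TangentSpace 𝓘(ℝ, E) y →L[ℝ] E) = mfderiv 𝓘(ℝ, E) 𝓘(ℝ, E) (extChartAt 𝓘(ℝ, E) x) y := by
  rw [← TangentBundle.continuousLinearMapAt_trivializationAt (I := 𝓘(ℝ, E)) (by simpa using hy)]
  exact ContinuousLinearMap.ext fun v => congrFun (Trivialization.coe_continuousLinearEquivAt_eq
    (R := ℝ) (tangentTriv E x) hy) v

/-- A constant vector field on a normed space. -/
def constField (w : E) : Π p : E, TangentSpace 𝓘(ℝ, E) p := fun _ => w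

/-- The tangent trivialization at `x` is the derivative of the chart at `x`, so the extensions
`constExt` are honest coordinate fields. -/
theorem mpullback_extChartAt_constField {x y : M} (hy : y ∈ (tangentTriv E x).baseSet)
    (v : TangentSpace 𝓘(ℝ, E) x) :
    VectorField.mpullback 𝓘(ℝ, E) 𝓘(ℝ, E) (extChartAt 𝓘(ℝ, E) x)
      (constField ((tangentTriv E x) ⟨x, v⟩).2) y = constExt v y := by
  rw [VectorField.mpullback_apply, ← continuousLinearEquivAt_eq_mfderiv hy]
  exact congrArg (fun L : E →L[ℝ] TangentSpace 𝓘(ℝ, E) y => L _)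
    (ContinuousLinearMap.inverse_equiv ((tangentTriv E x).continuousLinearEquivAt ℝ y hy))

theorem mlieBracket_constField (w w' : E) (p : E) :
    VectorField.mlieBracket 𝓘(ℝ, E) (constField w) (constField w') p = 0 := by
  rw [← VectorField.mlieBracketWithin_univ, VectorField.mlieBracketWithin_eq_lieBracketWithin]
  have h (w : E) : fderivWithin ℝ (constField w : E → E) Set.univ p = 0 := by
    change fderivWithin ℝ (fun _ => w) Set.univ p = 0
    simp
  simp only [VectorField.lieBracketWithin, h]
  exact sub_self (0 : E)

theorem diffFieldAt_constField (w : E) (p : E) : DiffFieldAt (constField w) p := by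
  refine ContMDiffAt.mdifferentiableAt (n := 1) ?_ one_ne_zero
  exact contMDiffAt_vectorSpace_iff_contDiffAt.2 contDiffAt_const

theorem two_le_infty : (2 : WithTop ℕ∞) ≤ ∞ := by norm_cast

/-- The Lie bracket is natural under pull-back by the chart, and constant fields on a vector space
commute. -/
theorem mlieBracket_constExt {x y : M} (hy : y ∈ (tangentTriv E x).baseSet)
    (u v : TangentSpace 𝓘(ℝ, E) x) :
    VectorField.mlieBracket 𝓘(ℝ, E) (constExt u) (constExt v) y = 0 := by
  have h (w : TangentSpace 𝓘(ℝ, E) x) : constExt w =ᶠ[𝓝 y]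
      VectorField.mpullback 𝓘(ℝ, E) 𝓘(ℝ, E) (extChartAt 𝓘(ℝ, E) x)
        (constField ((tangentTriv E x) ⟨x, w⟩).2) := by
    filter_upwards [(tangentTriv E x).open_baseSet.mem_nhds hy] with y' hy'
    exact (mpullback_extChartAt_constField hy' w).symm
  have : IsManifold 𝓘(ℝ, E) (minSmoothness ℝ 2) M := by simpa using! (inferInstanceAs (IsManifold 𝓘(ℝ, E) 2 M))
  rw [Filter.EventuallyEq.mlieBracket_vectorField_eq (h u) (h v),
    ← VectorField.mpullback_mlieBracket (n := ∞) (diffFieldAt_constField _ _)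
      (diffFieldAt_constField _ _) (contMDiffAt_extChartAt' (by simpa using hy)) (by simpa using two_le_infty),
    VectorField.mpullback_apply, mlieBracket_constField, map_zero]

theorem contMDiffAt_extChartAt_symm {x y : M} (hy : y ∈ (tangentTriv E x).baseSet) :
    ContMDiffAt 𝓘(ℝ, E) 𝓘(ℝ, E) ∞ (extChartAt 𝓘(ℝ, E) x).symm (extChartAt 𝓘(ℝ, E) x y) := by
  have hs : y ∈ (extChartAt 𝓘(ℝ, E) x).source := by simpa using hy
  have h := contMDiffWithinAt_extChartAt_symm_range (I := 𝓘(ℝ, E)) (n := ∞) x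
    ((extChartAt 𝓘(ℝ, E) x).map_source hs)
  simpa [contMDiffWithinAt_univ] using h

theorem dirDeriv_constExt {x y : M} (hy : y ∈ (tangentTriv E x).baseSet)
    (v : TangentSpace 𝓘(ℝ, E) x) {f : M → ℝ} (hf : MDifferentiableAt 𝓘(ℝ, E) 𝓘(ℝ) f y) :
    dirDeriv (constExt v) f y = fderiv ℝ (f ∘ (extChartAt 𝓘(ℝ, E) x).symm)
      (extChartAt 𝓘(ℝ, E) x y) ((tangentTriv E x) ⟨x, v⟩).2 := by
  have hs : y ∈ (extChartAt 𝓘(ℝ, E) x).source := by simpa using hy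
  have hchart : MDifferentiableAt 𝓘(ℝ, E) 𝓘(ℝ, E) (extChartAt 𝓘(ℝ, E) x) y :=
    mdifferentiableAt_extChartAt (by simpa using hy)
  have hg : MDifferentiableAt 𝓘(ℝ, E) 𝓘(ℝ) (f ∘ (extChartAt 𝓘(ℝ, E) x).symm)
      (extChartAt 𝓘(ℝ, E) x y) := by
    refine MDifferentiableAt.comp (I' := 𝓘(ℝ, E)) _ ?_
      ((contMDiffAt_extChartAt_symm hy).mdifferentiableAt (by simp))
    rwa [(extChartAt 𝓘(ℝ, E) x).left_inv hs]
  have heq : f =ᶠ[𝓝 y] (f ∘ (extChartAt 𝓘(ℝ, E) x).symm) ∘ extChartAt 𝓘(ℝ, E) x := by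
    filter_upwards [(tangentTriv E x).open_baseSet.mem_nhds hy] with y' hy'
    simp only [Function.comp_apply]
    rw [(extChartAt 𝓘(ℝ, E) x).left_inv (by simpa using hy')]
  rw [dirDeriv, mvfderiv_congr heq, mvfderiv_comp y hg hchart,
    ← continuousLinearEquivAt_eq_mfderiv hy]
  have h1 : ((tangentTriv E x).continuousLinearEquivAt ℝ y hy) (constExt v y)
      = ((tangentTriv E x) ⟨x, v⟩).2 := tangentTriv_constExt hy v
  have h2 : mvfderiv 𝓘(ℝ, E) (f ∘ (extChartAt 𝓘(ℝ, E) x).symm) (extChartAt 𝓘(ℝ, E) x y)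
      = fderiv ℝ (f ∘ (extChartAt 𝓘(ℝ, E) x).symm) (extChartAt 𝓘(ℝ, E) x y) := by
    rw [← mfderiv_eq_fderiv]
    rfl
  rw [← h1, ← h2]
  rfl

theorem contDiffAt_comp_extChartAt_symm {x : M} {f : M → ℝ}
    (hf : ContMDiffAt 𝓘(ℝ, E) 𝓘(ℝ) ∞ f x) :
    ContDiffAt ℝ ∞ (f ∘ (extChartAt 𝓘(ℝ, E) x).symm) (extChartAt 𝓘(ℝ, E) x x) := by
  rw [← contMDiffAt_iff_contDiffAt]
  refine ContMDiffAt.comp (I' := 𝓘(ℝ, E)) _ ?_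
    (contMDiffAt_extChartAt_symm (mem_tangentTriv_baseSet x))
  rwa [extChartAt_to_inv]

theorem eventually_mdifferentiableAt {E' : Type*} [NormedAddCommGroup E'] [NormedSpace ℝ E']
    {H' : Type*} [TopologicalSpace H'] {I' : ModelWithCorners ℝ E' H'} {M' : Type*}
    [TopologicalSpace M'] [ChartedSpace H' M'] [IsManifold I' 1 M'] {f : M → M'} {x : M}
    (hf : ContMDiffAt 𝓘(ℝ, E) I' ∞ f x) : ∀ᶠ y in 𝓝 x, MDifferentiableAt 𝓘(ℝ, E) I' f y :=
  ((contMDiffAt_iff_contMDiffAt_nhds (n := 1) (by simp)).1 (hf.of_le (by norm_cast))).mono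
    fun _ hy => hy.mdifferentiableAt one_ne_zero

theorem dirDeriv_constExt_eventuallyEq {x : M} (v : TangentSpace 𝓘(ℝ, E) x) {f : M → ℝ}
    (hf : ContMDiffAt 𝓘(ℝ, E) 𝓘(ℝ) ∞ f x) :
    dirDeriv (constExt v) f =ᶠ[𝓝 x] fun y => fderiv ℝ (f ∘ (extChartAt 𝓘(ℝ, E) x).symm)
      (extChartAt 𝓘(ℝ, E) x y) ((tangentTriv E x) ⟨x, v⟩).2 := by
  filter_upwards [eventually_mem_tangentTriv_baseSet (E := E) x, eventually_mdifferentiableAt hf]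
    with y hy hy'
  exact dirDeriv_constExt hy v hy'

theorem contDiffAt_fderiv_apply {g : E → ℝ} {p : E} (hg : ContDiffAt ℝ ∞ g p) (w : E) :
    ContDiffAt ℝ ∞ (fun q => fderiv ℝ g q w) p :=
  (hg.fderiv_right (m := ∞) (by simp)).clm_apply contDiffAt_const

theorem contMDiffAt_dirDeriv_constExt {x : M} (v : TangentSpace 𝓘(ℝ, E) x) {f : M → ℝ}
    (hf : ContMDiffAt 𝓘(ℝ, E) 𝓘(ℝ) ∞ f x) :
    ContMDiffAt 𝓘(ℝ, E) 𝓘(ℝ) ∞ (dirDeriv (constExt v) f) x := by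
  refine ContMDiffAt.congr_of_eventuallyEq ?_ (dirDeriv_constExt_eventuallyEq v hf)
  exact (contDiffAt_fderiv_apply (contDiffAt_comp_extChartAt_symm hf) _).contMDiffAt.comp x
    contMDiffAt_extChartAt

theorem dirDeriv_constExt_dirDeriv_constExt {x : M} (u v : TangentSpace 𝓘(ℝ, E) x) {f : M → ℝ}
    (hf : ContMDiffAt 𝓘(ℝ, E) 𝓘(ℝ) ∞ f x) :
    dirDeriv (constExt u) (dirDeriv (constExt v) f) x
      = fderiv ℝ (fderiv ℝ (f ∘ (extChartAt 𝓘(ℝ, E) x).symm)) (extChartAt 𝓘(ℝ, E) x x)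
          ((tangentTriv E x) ⟨x, u⟩).2 ((tangentTriv E x) ⟨x, v⟩).2 := by
  have hg := contDiffAt_comp_extChartAt_symm hf
  rw [dirDeriv_constExt (mem_tangentTriv_baseSet x) _
    ((contMDiffAt_dirDeriv_constExt v hf).mdifferentiableAt (by simp))]
  have h : (dirDeriv (constExt v) f) ∘ (extChartAt 𝓘(ℝ, E) x).symm
      =ᶠ[𝓝 (extChartAt 𝓘(ℝ, E) x x)] fun q =>
        fderiv ℝ (f ∘ (extChartAt 𝓘(ℝ, E) x).symm) q ((tangentTriv E x) ⟨x, v⟩).2 := by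
    have hcont : Tendsto (extChartAt 𝓘(ℝ, E) x).symm (𝓝 (extChartAt 𝓘(ℝ, E) x x)) (𝓝 x) := by
      simpa using (continuousAt_extChartAt_symm (I := 𝓘(ℝ, E)) x).tendsto
    filter_upwards [hcont.eventually (dirDeriv_constExt_eventuallyEq v hf),
      extChartAt_target_mem_nhds (I := 𝓘(ℝ, E)) x] with q hq hq'
    rw [Function.comp_apply, hq, (extChartAt 𝓘(ℝ, E) x).right_inv hq']
  have hd : DifferentiableAt ℝ (fderiv ℝ (f ∘ (extChartAt 𝓘(ℝ, E) x).symm))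
      (extChartAt 𝓘(ℝ, E) x x) :=
    (hg.fderiv_right (m := ∞) (by simp)).differentiableAt (by simp)
  rw [h.fderiv_eq, fderiv_clm_apply hd (differentiableAt_const _)]
  simp

/-- In the chart the directions are constant, so this is the symmetry of the second derivative. It
is the analytic source of the Ricci identity below. -/
theorem dirDeriv_constExt_comm {x : M} (u v : TangentSpace 𝓘(ℝ, E) x) {f : M → ℝ}
    (hf : ContMDiffAt 𝓘(ℝ, E) 𝓘(ℝ) ∞ f x) :
    dirDeriv (constExt u) (dirDeriv (constExt v) f) x
      = dirDeriv (constExt v) (dirDeriv (constExt u) f) x := by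
  rw [dirDeriv_constExt_dirDeriv_constExt u v hf, dirDeriv_constExt_dirDeriv_constExt v u hf]
  exact (contDiffAt_comp_extChartAt_symm hf).isSymmSndFDerivAt (by simpa using two_le_infty) _ _

end OneManifold

/-! ### Smooth vector fields along a map. -/

section AlongMap

variable {E : Type*} [NormedAddCommGroup E] [NormedSpace ℝ E] [FiniteDimensional ℝ E]
  {M : Type*} [TopologicalSpace M] [ChartedSpace E M] [IsManifold 𝓘(ℝ, E) ∞ M]
  [RiemannianBundle (fun x : M => TangentSpace 𝓘(ℝ, E) x)]
  {F : Type*} [NormedAddCommGroup F] [NormedSpace ℝ F] [FiniteDimensional ℝ F]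
  {N : Type*} [TopologicalSpace N] [ChartedSpace F N] [IsManifold 𝓘(ℝ, F) ∞ N]
  [RiemannianBundle (fun y : N => TangentSpace 𝓘(ℝ, F) y)]

/-- Smoothness at a point of a vector field along a map. -/
abbrev SmoothAlongAt (φ : M → N) (V : Π y : M, TangentSpace 𝓘(ℝ, F) (φ y)) (x : M) : Prop :=
  ContMDiffAt 𝓘(ℝ, E) 𝓘(ℝ, F).tangent ∞ (fun y => (⟨φ y, V y⟩ : TangentBundle 𝓘(ℝ, F) N)) x

section Basic

variable {φ : M → N} {V W : Π y : M, TangentSpace 𝓘(ℝ, F) (φ y)} {f : M → ℝ} {x : M}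

theorem smoothAlongAt_iff {z : N} (hz : φ x ∈ (tangentTriv F z).baseSet) :
    SmoothAlongAt (E := E) φ V x ↔ ContMDiffAt 𝓘(ℝ, E) 𝓘(ℝ, F) ∞ φ x ∧
      ContMDiffAt 𝓘(ℝ, E) 𝓘(ℝ, F) ∞ (fun y => ((tangentTriv F z) ⟨φ y, V y⟩).2) x :=
  (tangentTriv F z).contMDiffAt_iff (f := fun y => (⟨φ y, V y⟩ : TangentBundle 𝓘(ℝ, F) N))
    ((tangentTriv F z).mem_source.2 hz)

theorem SmoothAlongAt.base (hV : SmoothAlongAt (E := E) φ V x) :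
    ContMDiffAt 𝓘(ℝ, E) 𝓘(ℝ, F) ∞ φ x :=
  ((smoothAlongAt_iff (mem_tangentTriv_baseSet _)).1 hV).1

theorem eventually_map_mem_baseSet (hφ : ContMDiffAt 𝓘(ℝ, E) 𝓘(ℝ, F) ∞ φ x) {z : N}
    (hz : φ x ∈ (tangentTriv F z).baseSet) : ∀ᶠ y in 𝓝 x, φ y ∈ (tangentTriv F z).baseSet :=
  hφ.continuousAt.eventually ((tangentTriv F z).open_baseSet.mem_nhds hz)

theorem SmoothAlongAt.add (hV : SmoothAlongAt (E := E) φ V x) (hW : SmoothAlongAt (E := E) φ W x) :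
    SmoothAlongAt (E := E) φ (fun y => V y + W y) x := by
  have hz := mem_tangentTriv_baseSet (E := F) (φ x)
  rw [smoothAlongAt_iff hz] at hV hW ⊢
  refine ⟨hV.1, (hV.2.add hW.2).congr_of_eventuallyEq ?_⟩
  filter_upwards [eventually_map_mem_baseSet hV.1 hz] with y hy
  exact (isLinearMap_tangentTriv hy).map_add _ _

theorem SmoothAlongAt.smul (hf : ContMDiffAt 𝓘(ℝ, E) 𝓘(ℝ) ∞ f x)
    (hV : SmoothAlongAt (E := E) φ V x) :
    SmoothAlongAt (E := E) φ (fun y => f y • V y) x := by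
  have hz := mem_tangentTriv_baseSet (E := F) (φ x)
  rw [smoothAlongAt_iff hz] at hV ⊢
  refine ⟨hV.1, (hf.smul hV.2).congr_of_eventuallyEq ?_⟩
  filter_upwards [eventually_map_mem_baseSet hV.1 hz] with y hy
  exact (isLinearMap_tangentTriv hy).map_smul _ _

theorem SmoothAlongAt.neg (hV : SmoothAlongAt (E := E) φ V x) :
    SmoothAlongAt (E := E) φ (fun y => - V y) x := by
  simpa using hV.smul (f := fun _ => (-1 : ℝ)) contMDiffAt_const

theorem SmoothAlongAt.sub (hV : SmoothAlongAt (E := E) φ V x) (hW : SmoothAlongAt (E := E) φ W x) :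
    SmoothAlongAt (E := E) φ (fun y => V y - W y) x := by
  simpa [sub_eq_add_neg] using hV.add hW.neg

theorem smoothAlongAt_zero (hφ : ContMDiffAt 𝓘(ℝ, E) 𝓘(ℝ, F) ∞ φ x) :
    SmoothAlongAt (E := E) φ (fun y => (0 : TangentSpace 𝓘(ℝ, F) (φ y))) x := by
  have hz := mem_tangentTriv_baseSet (E := F) (φ x)
  rw [smoothAlongAt_iff hz]
  refine ⟨hφ, (contMDiffAt_const (c := (0 : F))).congr_of_eventuallyEq ?_⟩
  filter_upwards [eventually_map_mem_baseSet hφ hz] with y hy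
  exact (isLinearMap_tangentTriv hy).map_zero

theorem smoothAlongAt_sum (hφ : ContMDiffAt 𝓘(ℝ, E) 𝓘(ℝ, F) ∞ φ x) {ι : Type*} (s : Finset ι)
    {V : ι → Π y : M, TangentSpace 𝓘(ℝ, F) (φ y)}
    (hV : ∀ i ∈ s, SmoothAlongAt (E := E) φ (V i) x) :
    SmoothAlongAt (E := E) φ (fun y => ∑ i ∈ s, V i y) x := by
  classical
  induction s using Finset.induction_on with
  | empty => simpa using smoothAlongAt_zero hφ
  | insert i s hi ih =>
    simp only [Finset.sum_insert hi]
    exact (hV i (Finset.mem_insert_self _ _)).add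
      (ih fun j hj => hV j (Finset.mem_insert_of_mem hj))

theorem SmoothFieldAt.comp {Z : Π z : N, TangentSpace 𝓘(ℝ, F) z} (hZ : SmoothFieldAt Z (φ x))
    (hφ : ContMDiffAt 𝓘(ℝ, E) 𝓘(ℝ, F) ∞ φ x) : SmoothAlongAt (E := E) φ (fun y => Z (φ y)) x :=
  ContMDiffAt.comp x (g := fun z => (⟨z, Z z⟩ : TangentBundle 𝓘(ℝ, F) N)) hZ hφ

theorem SmoothAlongAt.congr (hV : SmoothAlongAt (E := E) φ V x) (h : ∀ᶠ y in 𝓝 x, W y = V y) :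
    SmoothAlongAt (E := E) φ W x :=
  ContMDiffAt.congr_of_eventuallyEq hV (h.mono fun y hy => by simp only [hy])

theorem SmoothAlongAt.frameCoeff (hV : SmoothAlongAt (E := E) φ V x) {z : N}
    (hz : φ x ∈ (tangentTriv F z).baseSet)
    (i : Fin (Module.finrank ℝ (TangentSpace 𝓘(ℝ, F) z))) :
    ContMDiffAt 𝓘(ℝ, E) 𝓘(ℝ) ∞ (fun y => frameCoeff z i (φ y) (V y)) x := by
  let L : F →ₗ[ℝ] ℝ :=
    { toFun := fun w => inner ℝ (frame F z i) ((tangentTriv F z).symm z w)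
      map_add' := fun v w => by
        rw [(isLinearMap_tangentTriv_symm (mem_tangentTriv_baseSet z)).map_add, inner_add_right]
      map_smul' := fun c v => by
        rw [(isLinearMap_tangentTriv_symm (mem_tangentTriv_baseSet z)).map_smul,
          inner_smul_right]
        rfl }
  exact (LinearMap.toContinuousLinearMap L).contDiff.contMDiff.contMDiffAt.comp x
    ((smoothAlongAt_iff hz).1 hV).2

theorem SmoothAlongAt.sum_frameCoeff (hφ : ContMDiffAt 𝓘(ℝ, E) 𝓘(ℝ, F) ∞ φ x)
    (V : Π y : M, TangentSpace 𝓘(ℝ, F) (φ y)) :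
    ∀ᶠ y in 𝓝 x, V y =
      ∑ i, PolyharmonicMaps.frameCoeff (φ x) i (φ y) (V y) • constExt (frame F (φ x) i) (φ y) := by
  filter_upwards [eventually_map_mem_baseSet hφ (mem_tangentTriv_baseSet _)] with y hy
  exact (sum_frameCoeff_smul hy _).symm

variable [IsContMDiffRiemannianBundle 𝓘(ℝ, F) ∞ F (fun y : N => TangentSpace 𝓘(ℝ, F) y)]

theorem SmoothAlongAt.inner (hV : SmoothAlongAt (E := E) φ V x)
    (hW : SmoothAlongAt (E := E) φ W x) :
    ContMDiffAt 𝓘(ℝ, E) 𝓘(ℝ) ∞ (fun y => (inner ℝ (V y) (W y) : ℝ)) x :=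
  ContMDiffAt.inner_bundle (F := F) (E := fun y : N => TangentSpace 𝓘(ℝ, F) y) (b := φ) hV hW

end Basic

theorem smoothAlongAt_dmap {φ : M → N} (hφ : ContMDiff 𝓘(ℝ, E) 𝓘(ℝ, F) ∞ φ)
    {U : Π y : M, TangentSpace 𝓘(ℝ, E) y} {x : M} (hU : SmoothFieldAt U x) :
    SmoothAlongAt (E := E) φ (fun y => dmap E F φ y (U y)) x :=
  ContMDiffAt.comp x (g := tangentMap 𝓘(ℝ, E) 𝓘(ℝ, F) φ)
    (hφ.contMDiff_tangentMap (m := ∞) (by simp)).contMDiffAt hU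

end AlongMap

/-! ### Smoothness of brackets and covariant derivatives. -/

section OneManifold

variable {E : Type*} [NormedAddCommGroup E] [NormedSpace ℝ E] [FiniteDimensional ℝ E]
  {M : Type*} [TopologicalSpace M] [ChartedSpace E M] [IsManifold 𝓘(ℝ, E) ∞ M]
  [RiemannianBundle (fun x : M => TangentSpace 𝓘(ℝ, E) x)]
  {x : M} {U V W : Π y : M, TangentSpace 𝓘(ℝ, E) y}

theorem SmoothFieldAt.frameCoeff (hV : SmoothFieldAt V x) {z : M}
    (hz : x ∈ (tangentTriv E z).baseSet)
    (i : Fin (Module.finrank ℝ (TangentSpace 𝓘(ℝ, E) z))) :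
    ContMDiffAt 𝓘(ℝ, E) 𝓘(ℝ) ∞ (fun y => frameCoeff z i y (V y)) x :=
  SmoothAlongAt.frameCoeff (φ := fun y : M => y) hV hz i

theorem SmoothFieldAt.dirDeriv {f : M → ℝ} (hU : SmoothFieldAt U x)
    (hf : ContMDiffAt 𝓘(ℝ, E) 𝓘(ℝ) ∞ f x) :
    ContMDiffAt 𝓘(ℝ, E) 𝓘(ℝ) ∞ (dirDeriv U f) x := by
  have h : PolyharmonicMaps.dirDeriv U f =ᶠ[𝓝 x] fun y =>
      ∑ i, PolyharmonicMaps.frameCoeff x i y (U y)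
        * PolyharmonicMaps.dirDeriv (constExt (frame E x i)) f y := by
    filter_upwards [eventually_mem_tangentTriv_baseSet (E := E) x] with y hy
    conv_lhs => rw [PolyharmonicMaps.dirDeriv, ← sum_frameCoeff_smul hy (U y)]
    rw [map_sum]
    simp [PolyharmonicMaps.dirDeriv]
  refine ContMDiffAt.congr_of_eventuallyEq ?_ h
  refine ContMDiffAt.sum fun i _ => ?_
  exact (hU.frameCoeff (mem_tangentTriv_baseSet x) i).mul (contMDiffAt_dirDeriv_constExt _ hf)

variable [IsContMDiffRiemannianBundle 𝓘(ℝ, E) ∞ E (fun x : M => TangentSpace 𝓘(ℝ, E) x)]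

theorem SmoothFieldAt.inner (hV : SmoothFieldAt V x) (hW : SmoothFieldAt W x) :
    ContMDiffAt 𝓘(ℝ, E) 𝓘(ℝ) ∞ (fun y => (inner ℝ (V y) (W y) : ℝ)) x :=
  SmoothAlongAt.inner (φ := fun y : M => y) hV hW

theorem SmoothFieldAt.mlieBracket (hV : SmoothFieldAt V x) (hW : SmoothFieldAt W x) :
    SmoothFieldAt (VectorField.mlieBracket 𝓘(ℝ, E) V W) x := by
  have : IsManifold 𝓘(ℝ, E) (((⊤ : ℕ∞) : WithTop ℕ∞) + 1) M := by
    simpa using! (inferInstanceAs (IsManifold 𝓘(ℝ, E) ∞ M))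
  have : IsManifold 𝓘(ℝ, E) (minSmoothness ℝ 2) M := by
    simpa using! (inferInstanceAs (IsManifold 𝓘(ℝ, E) 2 M))
  exact ContMDiffAt.mlieBracket_vectorField (m := ⊤) (n := ⊤) hV hW (by simp)

theorem SmoothFieldAt.koszul (hU : SmoothFieldAt U x) (hV : SmoothFieldAt V x)
    (hW : SmoothFieldAt W x) : ContMDiffAt 𝓘(ℝ, E) 𝓘(ℝ) ∞ (koszul U V W) x := by
  refine contMDiffAt_const.mul ?_
  exact (((((hU.dirDeriv (hV.inner hW)).add (hV.dirDeriv (hU.inner hW))).sub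
    (hW.dirDeriv (hU.inner hV))).add ((hU.mlieBracket hV).inner hW)).sub
    ((hU.mlieBracket hW).inner hV)).sub ((hV.mlieBracket hW).inner hU)

/-- A vector field is smooth at `x` if its inner products with the coordinate frame are. -/
theorem smoothFieldAt_of_inner
    (h : ∀ v : TangentSpace 𝓘(ℝ, E) x,
      ContMDiffAt 𝓘(ℝ, E) 𝓘(ℝ) ∞ (fun y => (inner ℝ (V y) (constExt v y) : ℝ)) x) :
    SmoothFieldAt V x := by
  -- The Gram matrix of the coordinate frame. It is the identity at `x`, where the frame is
  -- orthonormal, so it is invertible nearby, and its inverse is smooth by Cramer's rule.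
  let G : M → Matrix (Fin (Module.finrank ℝ (TangentSpace 𝓘(ℝ, E) x)))
      (Fin (Module.finrank ℝ (TangentSpace 𝓘(ℝ, E) x))) ℝ :=
    fun y => Matrix.of fun i j => inner ℝ (constExt (frame E x i) y) (constExt (frame E x j) y)
  have hG (i j) : ContMDiffAt 𝓘(ℝ, E) 𝓘(ℝ) ∞ (fun y => G y i j) x :=
    (smoothFieldAt_constExt _).inner (smoothFieldAt_constExt _)
  have hdet (A : M → Matrix (Fin (Module.finrank ℝ (TangentSpace 𝓘(ℝ, E) x)))
      (Fin (Module.finrank ℝ (TangentSpace 𝓘(ℝ, E) x))) ℝ)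
      (hA : ∀ i j, ContMDiffAt 𝓘(ℝ, E) 𝓘(ℝ) ∞ (fun y => A y i j) x) :
      ContMDiffAt 𝓘(ℝ, E) 𝓘(ℝ) ∞ (fun y => (A y).det) x := by
    simp only [Matrix.det_apply]
    refine ContMDiffAt.sum fun σ _ => ?_
    simp only [Units.smul_def, zsmul_eq_mul]
    exact contMDiffAt_const.mul (contMDiffAt_finsetProd fun i _ => hA _ _)
  have hdetx : (G x).det ≠ 0 := by
    have : G x = 1 := by
      ext i j
      simp [G, Matrix.one_apply, orthonormal_iff_ite.1 (frame E x).orthonormal i j]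
    simp [this]
  have hinv (i j) : ContMDiffAt 𝓘(ℝ, E) 𝓘(ℝ) ∞ (fun y => (G y)⁻¹ i j) x := by
    simp only [Matrix.inv_def, Matrix.smul_apply, Ring.inverse_eq_inv', smul_eq_mul,
      Matrix.adjugate_apply]
    refine ContMDiffAt.mul ?_ ?_
    · exact (contDiffAt_inv ℝ hdetx).contMDiffAt.comp x (hdet G hG)
    · refine hdet _ fun k l => ?_
      by_cases hk : k = j
      · simpa [hk] using contMDiffAt_const
      · simpa [Matrix.updateRow_ne hk] using hG k l
  have hS : SmoothFieldAt (fun y => ∑ i, (∑ j, inner ℝ (V y) (constExt (frame E x j) y)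
      * (G y)⁻¹ j i) • constExt (frame E x i) y) x := by
    refine smoothAlongAt_sum (φ := fun y : M => y) contMDiffAt_id _ fun i _ => ?_
    refine SmoothAlongAt.smul (φ := fun y : M => y) ?_ (smoothFieldAt_constExt _)
    exact ContMDiffAt.sum fun j _ => (h _).mul (hinv j i)
  refine SmoothAlongAt.congr (φ := fun y : M => y) hS ?_
  filter_upwards [eventually_mem_tangentTriv_baseSet (E := E) x,
    (hdet G hG).continuousAt.eventually_ne hdetx] with y hy hy'
  -- The inner products with the frame are the components of `V` times the Gram matrix, so
  -- multiplying by the inverse recovers the components.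
  have hr : (fun j => inner ℝ (V y) (constExt (frame E x j) y))
      = Matrix.vecMul (fun i => frameCoeff x i y (V y)) (G y) := by
    ext j
    conv_lhs => rw [← sum_frameCoeff_smul hy (V y)]
    simp [Matrix.vecMul, dotProduct, G, sum_inner, inner_smul_left]
  have hc : Matrix.vecMul (fun j => inner ℝ (V y) (constExt (frame E x j) y)) (G y)⁻¹
      = fun i => frameCoeff x i y (V y) := by
    rw [hr, Matrix.vecMul_vecMul, Matrix.mul_nonsing_inv _ (isUnit_iff_ne_zero.2 hy'),
      Matrix.vecMul_one]
  conv_lhs => rw [← sum_frameCoeff_smul hy (V y)]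
  refine Finset.sum_congr rfl fun i _ => ?_
  rw [← congrFun hc i]
  rfl

theorem SmoothFieldAt.nabla (hV : SmoothFieldAt V x) (hU : SmoothFieldAt U x) :
    SmoothFieldAt (fun y => nabla V y (U y)) x := by
  refine smoothFieldAt_of_inner fun v => ?_
  refine (hU.koszul hV (smoothFieldAt_constExt v)).congr_of_eventuallyEq ?_
  have hd {W : Π y : M, TangentSpace 𝓘(ℝ, E) y} (hW : SmoothFieldAt W x) :
      ∀ᶠ y in 𝓝 x, DiffFieldAt W y := eventually_mdifferentiableAt hW
  filter_upwards [hd hV, hd hU, hd (smoothFieldAt_constExt v)] with y h1 h2 h3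
  exact inner_nabla h2 h1 h3

end OneManifold

/-! ### The pull-back connection. -/

section AlongMap

variable {E : Type*} [NormedAddCommGroup E] [NormedSpace ℝ E] [FiniteDimensional ℝ E]
  {M : Type*} [TopologicalSpace M] [ChartedSpace E M] [IsManifold 𝓘(ℝ, E) ∞ M]
  [RiemannianBundle (fun x : M => TangentSpace 𝓘(ℝ, E) x)]
  {F : Type*} [NormedAddCommGroup F] [NormedSpace ℝ F] [FiniteDimensional ℝ F]
  {N : Type*} [TopologicalSpace N] [ChartedSpace F N] [IsManifold 𝓘(ℝ, F) ∞ N]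
  [RiemannianBundle (fun y : N => TangentSpace 𝓘(ℝ, F) y)]

/-- Smoothness on the whole trivialization domain, not just at its centre: a frame fixed at one
point gets differentiated at the neighbouring points. -/
theorem smoothFieldAt_constExt_of_mem {z z' : N} (hz : z' ∈ (tangentTriv F z).baseSet)
    (w : TangentSpace 𝓘(ℝ, F) z) : SmoothFieldAt (constExt w) z' := by
  refine (smoothAlongAt_iff (φ := fun y : N => y) (V := constExt w) hz).2 ⟨contMDiffAt_id, ?_⟩
  refine (contMDiffAt_const (c := ((tangentTriv F z) ⟨z, w⟩).2)).congr_of_eventuallyEq ?_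
  filter_upwards [(tangentTriv F z).open_baseSet.mem_nhds hz] with y hy
  exact tangentTriv_constExt hy w

section Sums

variable [IsContMDiffRiemannianBundle 𝓘(ℝ, F) ∞ F (fun y : N => TangentSpace 𝓘(ℝ, F) y)]

theorem nabla_add_constExt {z : N} (u v w : TangentSpace 𝓘(ℝ, F) z) :
    nabla (constExt (u + v)) z w = nabla (constExt u) z w + nabla (constExt v) z w := by
  rw [← nabla_add (diffFieldAt_constExt u) (diffFieldAt_constExt v)]
  refine nabla_congr ?_ w
  filter_upwards [eventually_mem_tangentTriv_baseSet (E := F) z] with y hy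
  exact (isLinearMap_constExt hy).map_add u v

theorem nabla_smul_constExt {z : N} (c : ℝ) (v w : TangentSpace 𝓘(ℝ, F) z) :
    nabla (constExt (c • v)) z w = c • nabla (constExt v) z w := by
  have h := nabla_smul (f := fun _ : N => c) mdifferentiableAt_const (diffFieldAt_constExt v) w
  rw [mvfderiv_const, _root_.zero_apply, zero_smul, add_zero] at h
  rw [← h]
  refine nabla_congr ?_ w
  filter_upwards [eventually_mem_tangentTriv_baseSet (E := F) z] with y hy
  exact (isLinearMap_constExt hy).map_smul c v

end Sums

/-- An operation on vector fields along `φ` which is local, additive and linear over smooth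
functions at `x`. -/
structure TensorialAlongAt (φ : M → N) {A : Type*} [AddCommGroup A] [Module ℝ A]
    (Φ : (Π y : M, TangentSpace 𝓘(ℝ, F) (φ y)) → A) (x : M) : Prop where
  add : ∀ {V W : Π y : M, TangentSpace 𝓘(ℝ, F) (φ y)}, SmoothAlongAt (E := E) φ V x →
    SmoothAlongAt (E := E) φ W x → Φ (fun y => V y + W y) = Φ V + Φ W
  smul : ∀ {f : M → ℝ} {V : Π y : M, TangentSpace 𝓘(ℝ, F) (φ y)},
    ContMDiffAt 𝓘(ℝ, E) 𝓘(ℝ) ∞ f x → SmoothAlongAt (E := E) φ V x →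
    Φ (fun y => f y • V y) = f x • Φ V
  congr : ∀ {V W : Π y : M, TangentSpace 𝓘(ℝ, F) (φ y)}, (∀ᶠ y in 𝓝 x, V y = W y) → Φ V = Φ W

section Tensorial

variable {φ : M → N} {A : Type*} [AddCommGroup A] [Module ℝ A]
  {Φ : (Π y : M, TangentSpace 𝓘(ℝ, F) (φ y)) → A} {x : M}

theorem TensorialAlongAt.sum (hΦ : TensorialAlongAt (E := E) φ Φ x)
    (hφ : ContMDiffAt 𝓘(ℝ, E) 𝓘(ℝ, F) ∞ φ x) {ι : Type*} (s : Finset ι)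
    {V : ι → Π y : M, TangentSpace 𝓘(ℝ, F) (φ y)}
    (hV : ∀ i ∈ s, SmoothAlongAt (E := E) φ (V i) x) :
    Φ (fun y => ∑ i ∈ s, V i y) = ∑ i ∈ s, Φ (V i) := by
  classical
  induction s using Finset.induction_on with
  | empty =>
    simpa using hΦ.smul (f := fun _ => (0 : ℝ)) contMDiffAt_const (smoothAlongAt_zero hφ)
  | insert i s hi ih =>
    simp only [Finset.sum_insert hi]
    rw [hΦ.add (hV i (Finset.mem_insert_self _ _)) (smoothAlongAt_sum hφ s fun j hj =>
      hV j (Finset.mem_insert_of_mem hj)), ih fun j hj => hV j (Finset.mem_insert_of_mem hj)]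

theorem TensorialAlongAt.eq_sum (hΦ : TensorialAlongAt (E := E) φ Φ x)
    {V : Π y : M, TangentSpace 𝓘(ℝ, F) (φ y)} (hV : SmoothAlongAt (E := E) φ V x) :
    Φ V = ∑ i, frameCoeff (φ x) i (φ x) (V x) •
      Φ (fun y => constExt (frame F (φ x) i) (φ y)) := by
  have hZ (i) : SmoothAlongAt (E := E) φ (fun y => constExt (frame F (φ x) i) (φ y)) x :=
    (smoothFieldAt_constExt _).comp hV.base
  have hc (i) := hV.frameCoeff (mem_tangentTriv_baseSet (φ x)) i
  rw [hΦ.congr (SmoothAlongAt.sum_frameCoeff hV.base V),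
    hΦ.sum hV.base _ fun i _ => (hZ i).smul (hc i)]
  exact Finset.sum_congr rfl fun i _ => hΦ.smul (hc i) (hZ i)

theorem TensorialAlongAt.pointwise (hΦ : TensorialAlongAt (E := E) φ Φ x)
    {V W : Π y : M, TangentSpace 𝓘(ℝ, F) (φ y)} (hV : SmoothAlongAt (E := E) φ V x)
    (hW : SmoothAlongAt (E := E) φ W x) (h : V x = W x) : Φ V = Φ W := by
  rw [hΦ.eq_sum hV, hΦ.eq_sum hW, h]

/-- Reduces a tensorial identity to pulled-back coordinate fields, on which the pull-back connection
has no derivative part. -/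
theorem TensorialAlongAt.eq_constExt (hΦ : TensorialAlongAt (E := E) φ Φ x)
    {V : Π y : M, TangentSpace 𝓘(ℝ, F) (φ y)} (hV : SmoothAlongAt (E := E) φ V x) :
    Φ V = Φ (fun y => constExt (V x) (φ y)) :=
  hΦ.pointwise hV ((smoothFieldAt_constExt _).comp hV.base) (constExt_self _).symm

end Tensorial

section Connection

variable [IsContMDiffRiemannianBundle 𝓘(ℝ, F) ∞ F (fun y : N => TangentSpace 𝓘(ℝ, F) y)]
  {φ : M → N} {V W : Π y : M, TangentSpace 𝓘(ℝ, F) (φ y)} {f : M → ℝ} {x : M}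

theorem isLinearMap_dmap (φ : M → N) (x : M) : IsLinearMap ℝ (dmap E F φ x) :=
  (mfderiv 𝓘(ℝ, E) 𝓘(ℝ, F) φ x).toLinearMap.isLinear

theorem isLinearMap_covAlong (φ : M → N) (V : Π y : M, TangentSpace 𝓘(ℝ, F) (φ y)) (x : M) :
    IsLinearMap ℝ (covAlong E F φ V x) := by
  have h1 := isLinearMap_tangentTriv_symm (mem_tangentTriv_baseSet (E := F) (φ x))
  have h2 := isLinearMap_nabla (diffFieldAt_constExt (V x))
  have h3 := isLinearMap_dmap (E := E) (F := F) φ x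
  constructor
  · intro u v
    simp only [covAlong, map_add, h1.map_add, h2.map_add, h3.map_add]
    abel
  · intro c v
    simp only [covAlong, map_smul, h1.map_smul, h2.map_smul, h3.map_smul, smul_add]

theorem covAlong_congr (h : ∀ᶠ y in 𝓝 x, V y = W y) (v : TangentSpace 𝓘(ℝ, E) x) :
    covAlong E F φ V x v = covAlong E F φ W x v := by
  have h' : (fun y => ((tangentTriv F (φ x)) ⟨φ y, V y⟩).2) =ᶠ[𝓝 x]
      fun y => ((tangentTriv F (φ x)) ⟨φ y, W y⟩).2 := h.mono fun y hy => by simp only [hy]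
  simp only [covAlong]
  rw [mvfderiv_congr h', h.self_of_nhds]

theorem covAlong_add (hV : SmoothAlongAt (E := E) φ V x) (hW : SmoothAlongAt (E := E) φ W x)
    (v : TangentSpace 𝓘(ℝ, E) x) :
    covAlong E F φ (fun y => V y + W y) x v = covAlong E F φ V x v + covAlong E F φ W x v := by
  have hz := mem_tangentTriv_baseSet (E := F) (φ x)
  have hV' := ((smoothAlongAt_iff hz).1 hV).2.mdifferentiableAt (by simp)
  have hW' := ((smoothAlongAt_iff hz).1 hW).2.mdifferentiableAt (by simp)
  have h : (fun y => ((tangentTriv F (φ x)) ⟨φ y, V y + W y⟩).2) =ᶠ[𝓝 x]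
      fun y => ((tangentTriv F (φ x)) ⟨φ y, V y⟩).2 + ((tangentTriv F (φ x)) ⟨φ y, W y⟩).2 := by
    filter_upwards [eventually_map_mem_baseSet hV.base hz] with y hy
    exact (isLinearMap_tangentTriv hy).map_add _ _
  simp only [covAlong]
  rw [mvfderiv_congr h, mvfderiv_fun_add hV' hW', nabla_add_constExt,
    _root_.add_apply, (isLinearMap_tangentTriv_symm hz).map_add]
  abel

theorem covAlong_zero (hφ : ContMDiffAt 𝓘(ℝ, E) 𝓘(ℝ, F) ∞ φ x) (v : TangentSpace 𝓘(ℝ, E) x) :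
    covAlong E F φ (fun _ => 0) x v = 0 := by
  have h := covAlong_add (smoothAlongAt_zero hφ) (smoothAlongAt_zero hφ) v
  simpa only [add_zero, left_eq_add] using h

theorem covAlong_sum (hφ : ContMDiffAt 𝓘(ℝ, E) 𝓘(ℝ, F) ∞ φ x) {ι : Type*} (s : Finset ι)
    {V : ι → Π y : M, TangentSpace 𝓘(ℝ, F) (φ y)}
    (hV : ∀ i ∈ s, SmoothAlongAt (E := E) φ (V i) x) (v : TangentSpace 𝓘(ℝ, E) x) :
    covAlong E F φ (fun y => ∑ i ∈ s, V i y) x v = ∑ i ∈ s, covAlong E F φ (V i) x v := by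
  classical
  induction s using Finset.induction_on with
  | empty => simpa using covAlong_zero hφ v
  | insert i s hi ih =>
    simp only [Finset.sum_insert hi]
    rw [covAlong_add (hV i (Finset.mem_insert_self _ _)) (smoothAlongAt_sum hφ s fun j hj =>
      hV j (Finset.mem_insert_of_mem hj)), ih fun j hj => hV j (Finset.mem_insert_of_mem hj)]

theorem covAlong_smul (hf : ContMDiffAt 𝓘(ℝ, E) 𝓘(ℝ) ∞ f x) (hV : SmoothAlongAt (E := E) φ V x)
    (v : TangentSpace 𝓘(ℝ, E) x) :
    covAlong E F φ (fun y => f y • V y) x v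
      = f x • covAlong E F φ V x v + mvfderiv 𝓘(ℝ, E) f x v • V x := by
  have hz := mem_tangentTriv_baseSet (E := F) (φ x)
  have hV' := ((smoothAlongAt_iff hz).1 hV).2.mdifferentiableAt (by simp)
  have h : (fun y => ((tangentTriv F (φ x)) ⟨φ y, f y • V y⟩).2) =ᶠ[𝓝 x]
      fun y => f y • ((tangentTriv F (φ x)) ⟨φ y, V y⟩).2 := by
    filter_upwards [eventually_map_mem_baseSet hV.base hz] with y hy
    exact (isLinearMap_tangentTriv hy).map_smul _ _
  simp only [covAlong]
  rw [mvfderiv_congr h, mvfderiv_fun_smul (hf.mdifferentiableAt (by simp)) hV',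
    nabla_smul_constExt, _root_.add_apply,
    (isLinearMap_tangentTriv_symm hz).map_add, _root_.smul_apply,
    (isLinearMap_tangentTriv_symm hz).map_smul, ContinuousLinearMap.smulRight_apply,
    (isLinearMap_tangentTriv_symm hz).map_smul, Trivialization.symm_apply_apply_mk _ hz, smul_add]
  abel

/-- The fibre component is constant in the trivialization at `φ x`, so only the connection term
survives. -/
theorem covAlong_constExt_comp (hφ : ContMDiffAt 𝓘(ℝ, E) 𝓘(ℝ, F) ∞ φ x)
    (w : TangentSpace 𝓘(ℝ, F) (φ x)) (v : TangentSpace 𝓘(ℝ, E) x) :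
    covAlong E F φ (fun y => constExt w (φ y)) x v = nabla (constExt w) (φ x) (dmap E F φ x v) := by
  have hz := mem_tangentTriv_baseSet (E := F) (φ x)
  have h : (fun y => ((tangentTriv F (φ x)) ⟨φ y, constExt w (φ y)⟩).2) =ᶠ[𝓝 x]
      fun _ => ((tangentTriv F (φ x)) ⟨φ x, w⟩).2 := by
    filter_upwards [eventually_map_mem_baseSet hφ hz] with y hy
    exact tangentTriv_constExt hy w
  simp only [covAlong]
  rw [mvfderiv_congr h, mvfderiv_const, _root_.zero_apply,
    (isLinearMap_tangentTriv_symm hz).map_zero, zero_add, constExt_self]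

theorem mvfderiv_comp_map {g : N → ℝ} (hφ : ContMDiffAt 𝓘(ℝ, E) 𝓘(ℝ, F) ∞ φ x)
    (hg : ContMDiffAt 𝓘(ℝ, F) 𝓘(ℝ) ∞ g (φ x)) (v : TangentSpace 𝓘(ℝ, E) x) :
    mvfderiv 𝓘(ℝ, E) (fun y => g (φ y)) x v = mvfderiv 𝓘(ℝ, F) g (φ x) (dmap E F φ x v) := by
  have h := mvfderiv_comp x (hg.mdifferentiableAt (by simp)) (hφ.mdifferentiableAt (by simp))
  exact congrArg (fun L => L v) h

/-- The pull-back connection on the restriction to `φ` of a vector field on `N`. -/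
theorem covAlong_comp (hφ : ContMDiffAt 𝓘(ℝ, E) 𝓘(ℝ, F) ∞ φ x)
    {Z : Π z : N, TangentSpace 𝓘(ℝ, F) z} (hZ : SmoothFieldAt Z (φ x))
    (v : TangentSpace 𝓘(ℝ, E) x) :
    covAlong E F φ (fun y => Z (φ y)) x v = nabla Z (φ x) (dmap E F φ x v) := by
  -- The defect of the identity as a function of `Z`. The two Leibniz terms agree by the chain rule,
  -- so it is tensorial on `N`, and it vanishes on coordinate fields.
  let Φ : (Π z : N, TangentSpace 𝓘(ℝ, F) z) → TangentSpace 𝓘(ℝ, F) (φ x) := fun Z =>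
    covAlong E F φ (fun y => Z (φ y)) x v - nabla Z (φ x) (dmap E F φ x v)
  have hΦ : TensorialAlongAt (E := F) (fun z : N => z) Φ (φ x) := by
    constructor
    · intro Z W hZ hW
      have hZ' : SmoothFieldAt Z (φ x) := hZ
      have hW' : SmoothFieldAt W (φ x) := hW
      have h := nabla_add hZ'.diff hW'.diff (dmap E F φ x v)
      simp only [Φ]
      rw [covAlong_add (hZ'.comp hφ) (hW'.comp hφ)]
      refine (congrArg _ h).trans ?_
      abel
    · intro f Z hf hZ
      have hZ' : SmoothFieldAt Z (φ x) := hZ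
      have h := nabla_smul (hf.mdifferentiableAt (by simp)) hZ'.diff (dmap E F φ x v)
      simp only [Φ]
      rw [covAlong_smul (f := fun y => f (φ y)) (hf.comp x hφ) (hZ'.comp hφ),
        mvfderiv_comp_map hφ hf]
      refine (congrArg _ h).trans ?_
      rw [smul_sub]
      abel
    · intro Z W h
      simp only [Φ]
      rw [covAlong_congr (W := fun y => W (φ y)) (hφ.continuousAt.eventually h)]
      exact congrArg _ (nabla_congr (x := φ x) h (dmap E F φ x v))
  have h := hΦ.eq_constExt hZ
  simp only [Φ] at h
  rw [covAlong_constExt_comp hφ, sub_self] at h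
  exact sub_eq_zero.1 h

/-- Metric compatibility of the pull-back connection. -/
theorem mvfderiv_inner_along (hV : SmoothAlongAt (E := E) φ V x)
    (hW : SmoothAlongAt (E := E) φ W x) (v : TangentSpace 𝓘(ℝ, E) x) :
    mvfderiv 𝓘(ℝ, E) (fun y => (inner ℝ (V y) (W y) : ℝ)) x v
      = inner ℝ (covAlong E F φ V x v) (W x) + inner ℝ (V x) (covAlong E F φ W x v) := by
  have hφ := hV.base
  -- The defect is symmetric and tensorial in each slot. On pulled-back coordinate fields it reduces
  -- to metric compatibility on `N`.
  let D : (Π y : M, TangentSpace 𝓘(ℝ, F) (φ y)) → (Π y : M, TangentSpace 𝓘(ℝ, F) (φ y)) → ℝ :=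
    fun V W => mvfderiv 𝓘(ℝ, E) (fun y => (inner ℝ (V y) (W y) : ℝ)) x v
      - inner ℝ (covAlong E F φ V x v) (W x) - inner ℝ (V x) (covAlong E F φ W x v)
  have hsymm (V W) : D V W = D W V := by
    simp only [D, real_inner_comm]
    ring
  have hD {W} (hW : SmoothAlongAt (E := E) φ W x) : TensorialAlongAt (E := E) φ (D · W) x := by
    constructor
    · intro V V' hV hV'
      simp only [D, inner_add_left, covAlong_add hV hV']
      rw [mvfderiv_fun_add ((hV.inner hW).mdifferentiableAt (by simp))
        ((hV'.inner hW).mdifferentiableAt (by simp)), _root_.add_apply]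
      ring
    · intro f V hf hV
      simp only [D, inner_smul_left, inner_add_left, covAlong_smul hf hV, conj_trivial]
      rw [mvfderiv_fun_mul (hf.mdifferentiableAt (by simp))
        ((hV.inner hW).mdifferentiableAt (by simp)), _root_.add_apply,
        _root_.smul_apply, _root_.smul_apply]
      simp only [smul_eq_mul]
      ring
    · intro V V' h
      simp only [D]
      rw [covAlong_congr h, h.self_of_nhds, mvfderiv_congr (g := fun y => inner ℝ (V' y) (W y))
        (h.mono fun y hy => by simp only [hy])]
  have hZ (w : TangentSpace 𝓘(ℝ, F) (φ x)) :
      SmoothAlongAt (E := E) φ (fun y => constExt w (φ y)) x :=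
    (smoothFieldAt_constExt w).comp hφ
  have h0 : D V W = 0 := by
    rw [(hD hW).eq_constExt hV, hsymm, (hD (hZ _)).eq_constExt hW, hsymm]
    simp only [D]
    rw [covAlong_constExt_comp hφ, covAlong_constExt_comp hφ,
      mvfderiv_comp_map (g := fun z => inner ℝ (constExt (V x) z) (constExt (W x) z)) hφ
        ((smoothFieldAt_constExt _).inner (smoothFieldAt_constExt _)),
      mvfderiv_inner (diffFieldAt_constExt _) (diffFieldAt_constExt _)]
    simp
  simp only [D] at h0
  linarith

theorem SmoothAlongAt.nabla {Z : Π z : N, TangentSpace 𝓘(ℝ, F) z} (hZ : SmoothFieldAt Z (φ x))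
    (hV : SmoothAlongAt (E := E) φ V x) :
    SmoothAlongAt (E := E) φ (fun y => nabla Z (φ y) (V y)) x := by
  have h : SmoothAlongAt (E := E) φ (fun y => ∑ i, PolyharmonicMaps.frameCoeff (φ x) i (φ y) (V y) •
      PolyharmonicMaps.nabla Z (φ y) (constExt (frame F (φ x) i) (φ y))) x := by
    refine smoothAlongAt_sum hV.base _ fun i _ => ?_
    refine SmoothAlongAt.smul (hV.frameCoeff (mem_tangentTriv_baseSet _) i) ?_
    exact (hZ.nabla (smoothFieldAt_constExt _)).comp hV.base
  refine h.congr ?_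
  have hZ' : ∀ᶠ z in 𝓝 (φ x), DiffFieldAt Z z := eventually_mdifferentiableAt hZ
  filter_upwards [eventually_map_mem_baseSet hV.base (mem_tangentTriv_baseSet _),
    hV.base.continuousAt.eventually hZ'] with y hy hy'
  conv_lhs => rw [← sum_frameCoeff_smul hy (V y)]
  have h2 := isLinearMap_nabla hy'
  have h3 := map_sum (h2.mk' _) (fun i => PolyharmonicMaps.frameCoeff (φ x) i (φ y) (V y) •
    constExt (frame F (φ x) i) (φ y)) Finset.univ
  simpa only [IsLinearMap.mk'_apply, h2.map_smul] using h3

/-- The definition at `y` uses the trivialization at `φ y`, which changes with `y`. Expanding `V` in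
the single frame centred at `φ x` gives a formula that is visibly smooth. -/
theorem SmoothAlongAt.covAlong (hφ : ContMDiff 𝓘(ℝ, E) 𝓘(ℝ, F) ∞ φ)
    (hV : ∀ᶠ y in 𝓝 x, SmoothAlongAt (E := E) φ V y)
    {U : Π y : M, TangentSpace 𝓘(ℝ, E) y} (hU : SmoothFieldAt U x) :
    SmoothAlongAt (E := E) φ (fun y => covAlong E F φ V y (U y)) x := by
  have h : SmoothAlongAt (E := E) φ (fun y => ∑ i,
      (PolyharmonicMaps.frameCoeff (φ x) i (φ y) (V y) •
        PolyharmonicMaps.nabla (constExt (frame F (φ x) i)) (φ y) (dmap E F φ y (U y))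
      + dirDeriv U (fun y => PolyharmonicMaps.frameCoeff (φ x) i (φ y) (V y)) y •
        constExt (frame F (φ x) i) (φ y))) x := by
    refine smoothAlongAt_sum hφ.contMDiffAt _ fun i _ => ?_
    have hc := hV.self_of_nhds.frameCoeff (mem_tangentTriv_baseSet _) i
    refine (SmoothAlongAt.smul hc ?_).add (SmoothAlongAt.smul (hU.dirDeriv hc) ?_)
    · exact SmoothAlongAt.nabla (smoothFieldAt_constExt _) (smoothAlongAt_dmap hφ hU)
    · exact (smoothFieldAt_constExt _).comp hφ.contMDiffAt
  refine h.congr ?_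
  -- The frame expansion has to hold on a neighbourhood of each `y`, since it is differentiated
  -- there.
  filter_upwards [eventually_map_mem_baseSet hφ.contMDiffAt (mem_tangentTriv_baseSet (φ x)),
    (SmoothAlongAt.sum_frameCoeff hφ.contMDiffAt V).eventually_nhds, hV] with y hy hy1 hy2
  have hZ (i) := smoothFieldAt_constExt_of_mem hy (frame F (φ x) i)
  have hc (i) := hy2.frameCoeff hy i
  rw [covAlong_congr hy1, covAlong_sum hφ.contMDiffAt _ fun i _ =>
    SmoothAlongAt.smul (hc i) ((hZ i).comp hφ.contMDiffAt)]
  refine Finset.sum_congr rfl fun i _ => ?_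
  rw [covAlong_smul (hc i) ((hZ i).comp hφ.contMDiffAt), covAlong_comp hφ.contMDiffAt (hZ i)]
  rfl

end Connection

end AlongMap

/-! ### Curvature and Killing fields. -/

section OneManifold

variable {E : Type*} [NormedAddCommGroup E] [NormedSpace ℝ E] [FiniteDimensional ℝ E]
  {M : Type*} [TopologicalSpace M] [ChartedSpace E M] [IsManifold 𝓘(ℝ, E) ∞ M]
  [RiemannianBundle (fun x : M => TangentSpace 𝓘(ℝ, E) x)]

variable [IsContMDiffRiemannianBundle 𝓘(ℝ, E) ∞ E (fun x : M => TangentSpace 𝓘(ℝ, E) x)]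
  {x : M} {V W X : Π y : M, TangentSpace 𝓘(ℝ, E) y}

theorem SmoothFieldAt.eventually_diff (hV : SmoothFieldAt V x) : ∀ᶠ y in 𝓝 x, DiffFieldAt V y :=
  eventually_mdifferentiableAt hV

/-- Coordinate vector fields commute, hence so do their covariant derivatives. -/
theorem nabla_constExt_comm {x y : M} (hy : y ∈ (tangentTriv E x).baseSet)
    (u v : TangentSpace 𝓘(ℝ, E) x) :
    nabla (constExt v) y (constExt u y) = nabla (constExt u) y (constExt v y) := by
  rw [← sub_eq_zero, nabla_sub_nabla (smoothFieldAt_constExt_of_mem hy u).diff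
    (smoothFieldAt_constExt_of_mem hy v).diff, mlieBracket_constExt hy]

theorem curvature_eq (u v w : TangentSpace 𝓘(ℝ, E) x) :
    curvature u v w = nabla (fun y => nabla (constExt w) y (constExt v y)) x u
      - nabla (fun y => nabla (constExt w) y (constExt u y)) x v := by
  rw [curvature, mlieBracket_constExt (mem_tangentTriv_baseSet x),
    (isLinearMap_nabla (diffFieldAt_constExt w)).map_zero, sub_zero]

theorem curvature_swap (u v w : TangentSpace 𝓘(ℝ, E) x) : curvature v u w = -curvature u v w := by
  rw [curvature_eq, curvature_eq, neg_sub]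

/-- The first Bianchi identity. -/
theorem curvature_bianchi (u v w : TangentSpace 𝓘(ℝ, E) x) :
    curvature u v w + curvature v w u + curvature w u v = 0 := by
  -- Exchanging the two inner arguments makes the six second derivatives cancel in pairs.
  have h (a b c : TangentSpace 𝓘(ℝ, E) x) :
      nabla (fun y => nabla (constExt b) y (constExt a y)) x c
        = nabla (fun y => nabla (constExt a) y (constExt b y)) x c := by
    refine nabla_congr ?_ c
    filter_upwards [eventually_mem_tangentTriv_baseSet (E := E) x] with y hy
    exact nabla_constExt_comm hy a b
  rw [curvature_eq, curvature_eq, curvature_eq, h v w u, h w u v, h u v w]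
  abel

theorem mvfderiv_inner_nabla (hV : SmoothFieldAt V x) (hW : SmoothFieldAt W x)
    (u v : TangentSpace 𝓘(ℝ, E) x) :
    mvfderiv 𝓘(ℝ, E) (fun y => (inner ℝ (nabla V y (constExt v y)) (W y) : ℝ)) x u
      = inner ℝ (nabla (fun y => nabla V y (constExt v y)) x u) (W x)
        + inner ℝ (nabla V x v) (nabla W x u) := by
  rw [mvfderiv_inner (hV.nabla (smoothFieldAt_constExt v)).diff hW.diff, constExt_self]

theorem dirDeriv_dirDeriv_inner (hV : SmoothFieldAt V x) (hW : SmoothFieldAt W x)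
    (u v : TangentSpace 𝓘(ℝ, E) x) :
    dirDeriv (constExt u) (dirDeriv (constExt v) fun y => inner ℝ (V y) (W y)) x
      = inner ℝ (nabla (fun y => nabla V y (constExt v y)) x u) (W x)
        + inner ℝ (nabla V x v) (nabla W x u)
        + (inner ℝ (nabla (fun y => nabla W y (constExt v y)) x u) (V x)
        + inner ℝ (nabla W x v) (nabla V x u)) := by
  have h : (dirDeriv (constExt v) fun y => (inner ℝ (V y) (W y) : ℝ)) =ᶠ[𝓝 x] fun y =>
      inner ℝ (nabla V y (constExt v y)) (W y) + inner ℝ (nabla W y (constExt v y)) (V y) := by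
    filter_upwards [hV.eventually_diff, hW.eventually_diff] with y h1 h2
    rw [dirDeriv, mvfderiv_inner h1 h2, real_inner_comm (V y)]
  have hv := smoothFieldAt_constExt v
  rw [dirDeriv_congr _ h, dirDeriv_add _ (((hV.nabla hv).inner hW).mdifferentiableAt (by simp))
    (((hW.nabla hv).inner hV).mdifferentiableAt (by simp)), dirDeriv, dirDeriv, constExt_self,
    mvfderiv_inner_nabla hV hW, mvfderiv_inner_nabla hW hV]

/-- The commutator of second covariant derivatives of `V`, by duality. -/
theorem inner_nabla_nabla_sub (hV : SmoothFieldAt V x) (u v w : TangentSpace 𝓘(ℝ, E) x) :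
    inner ℝ (nabla (fun y => nabla V y (constExt v y)) x u
      - nabla (fun y => nabla V y (constExt u y)) x v) w = -inner ℝ (curvature u v w) (V x) := by
  have hw := smoothFieldAt_constExt w
  -- Antisymmetrizing the second derivative of ⟨V, w⟩ kills the mixed terms. The commutator on `V`
  -- is then minus that on the extension of `w`, which is the curvature by definition; no
  -- tensoriality of the curvature in its last slot is needed.
  have h := dirDeriv_constExt_comm u v (hV.inner hw)
  rw [dirDeriv_dirDeriv_inner hV hw, dirDeriv_dirDeriv_inner hV hw, constExt_self] at h
  rw [curvature_eq, inner_sub_left, inner_sub_left, real_inner_comm (nabla V x u),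
    real_inner_comm (nabla V x v)] at *
  linarith

theorem inner_nabla_killing (hX : IsKilling X) (u v : TangentSpace 𝓘(ℝ, E) x) :
    inner ℝ (nabla X x u) v = -inner ℝ u (nabla X x v) := by
  have h := hX.2 x u v
  rw [real_inner_comm _ u]
  linarith

/-- Kostant's identity for the second covariant derivative of a Killing vector field. -/
theorem inner_nabla_nabla_killing (hX : IsKilling X) (u v w : TangentSpace 𝓘(ℝ, E) x) :
    inner ℝ (nabla (fun y => nabla X y (constExt v y)) x u - nabla X x (nabla (constExt v) x u)) w
      = inner ℝ (curvature v w u) (X x) := by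
  have hXx : SmoothFieldAt X x := hX.1 x
  let T : TangentSpace 𝓘(ℝ, E) x → TangentSpace 𝓘(ℝ, E) x → TangentSpace 𝓘(ℝ, E) x → ℝ :=
    fun u v w => inner ℝ (nabla (fun y => nabla X y (constExt v y)) x u
      - nabla X x (nabla (constExt v) x u)) w
  let c : TangentSpace 𝓘(ℝ, E) x → TangentSpace 𝓘(ℝ, E) x → TangentSpace 𝓘(ℝ, E) x → ℝ :=
    fun u v w => inner ℝ (curvature u v w) (X x)
  -- Differentiating the Killing equation makes ∇²X skew in its last two slots; the correction terms
  -- vanish by the Killing equation itself.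
  have hT (u v w) : T u v w = -T u w v := by
    have h0 : (fun y => (inner ℝ (nabla X y (constExt v y)) (constExt w y)
        + inner ℝ (nabla X y (constExt w y)) (constExt v y) : ℝ)) = fun _ => 0 :=
      funext fun y => hX.2 y _ _
    have hv := smoothFieldAt_constExt v
    have hw := smoothFieldAt_constExt w
    have h1 := mvfderiv_fun_add (((hXx.nabla hv).inner hw).mdifferentiableAt (by simp))
      (((hXx.nabla hw).inner hv).mdifferentiableAt (by simp))
    rw [h0, mvfderiv_const] at h1
    have h2 := congrArg (fun L => L u) h1
    simp only [_root_.zero_apply, _root_.add_apply] at h2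
    rw [mvfderiv_inner_nabla hXx hw, mvfderiv_inner_nabla hXx hv, constExt_self,
      constExt_self] at h2
    have h3 := hX.2 x v (nabla (constExt w) x u)
    have h4 := hX.2 x w (nabla (constExt v) x u)
    simp only [T, inner_sub_left]
    linarith
  -- The Ricci identity; the corrections cancel because coordinate fields commute.
  have hTc (u v w) : T u v w - T v u w = -c u v w := by
    have h1 := nabla_constExt_comm (mem_tangentTriv_baseSet x) u v
    rw [constExt_self, constExt_self] at h1
    have h2 := inner_nabla_nabla_sub hXx u v w
    simp only [T, c, inner_sub_left, h1] at h2 ⊢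
    linarith
  have hc (u v w) : c v u w = -c u v w := by
    simp only [c, curvature_swap u v w, inner_neg_left]
  have hb : c u v w + c v w u + c w u v = 0 := by
    simp only [c, ← inner_add_left, curvature_bianchi, inner_zero_left]
  -- Alternating `hT` and `hTc` around the six permutations gives 2 T(u,v,w) = c(v,w,u) - c(u,v,w) -
  -- c(w,u,v), which equals 2 c(v,w,u) by Bianchi.
  change T u v w = c v w u
  linarith [hT u v w, hT v w u, hT w u v, hTc u v w, hTc v w u, hTc w u v, hc u v w, hc v w u,
    hc w u v, hT v u w, hT w v u, hT u w v]

end OneManifold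

/-! ### Kostant's identity along a map. -/

section AlongMap

variable {E : Type*} [NormedAddCommGroup E] [NormedSpace ℝ E] [FiniteDimensional ℝ E]
  {M : Type*} [TopologicalSpace M] [ChartedSpace E M] [IsManifold 𝓘(ℝ, E) ∞ M]
  [RiemannianBundle (fun x : M => TangentSpace 𝓘(ℝ, E) x)]
  {F : Type*} [NormedAddCommGroup F] [NormedSpace ℝ F] [FiniteDimensional ℝ F]
  {N : Type*} [TopologicalSpace N] [ChartedSpace F N] [IsManifold 𝓘(ℝ, F) ∞ N]
  [RiemannianBundle (fun y : N => TangentSpace 𝓘(ℝ, F) y)]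
  [IsContMDiffRiemannianBundle 𝓘(ℝ, F) ∞ F (fun y : N => TangentSpace 𝓘(ℝ, F) y)]
  {φ : M → N} {V : Π y : M, TangentSpace 𝓘(ℝ, F) (φ y)} {x : M}
  {X : Π y : N, TangentSpace 𝓘(ℝ, F) y}

/-- The product rule for ∇X applied to `V`, with the derivative of ∇X in the direction dφ(v)
supplied by Kostant's identity. -/
theorem inner_covAlong_nabla_killing (hX : IsKilling X) (hV : SmoothAlongAt (E := E) φ V x)
    (v : TangentSpace 𝓘(ℝ, E) x) (w : TangentSpace 𝓘(ℝ, F) (φ x)) :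
    inner ℝ (covAlong E F φ (fun y => nabla X (φ y) (V y)) x v) w
      = inner ℝ (nabla X (φ x) (covAlong E F φ V x v)) w
        + inner ℝ (curvature (V x) w (dmap E F φ x v)) (X (φ x)) := by
  have hφ := hV.base
  have hXs (z : N) : SmoothFieldAt X z := hX.1 z
  have hK (z : N) := isLinearMap_nabla (hXs z).diff
  -- This difference is tensorial in `V`, so `V` may be replaced by a pulled-back coordinate field.
  let Φ : (Π y : M, TangentSpace 𝓘(ℝ, F) (φ y)) → TangentSpace 𝓘(ℝ, F) (φ x) := fun V =>
    covAlong E F φ (fun y => nabla X (φ y) (V y)) x v - nabla X (φ x) (covAlong E F φ V x v)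
  have hΦ : TensorialAlongAt (E := E) φ Φ x := by
    constructor
    · intro V W hV hW
      simp only [Φ]
      rw [covAlong_add hV hW]
      simp only [(hK _).map_add]
      rw [covAlong_add (SmoothAlongAt.nabla (hXs _) hV) (SmoothAlongAt.nabla (hXs _) hW)]
      abel
    · intro f V hf hV
      simp only [Φ]
      rw [covAlong_smul hf hV]
      simp only [(hK _).map_smul, (hK _).map_add]
      rw [covAlong_smul hf (SmoothAlongAt.nabla (hXs _) hV), smul_sub]
      abel
    · intro V W h
      simp only [Φ]
      rw [covAlong_congr h, covAlong_congr (V := fun y => nabla X (φ y) (V y))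
        (W := fun y => nabla X (φ y) (W y)) (h.mono fun y hy => by rw [hy])]
  have h := hΦ.eq_constExt hV
  have h2 := inner_nabla_nabla_killing hX (dmap E F φ x v) (V x) w
  rw [← covAlong_constExt_comp hφ (V x) v, ← covAlong_comp hφ
    ((hXs _).nabla (smoothFieldAt_constExt _)) v] at h2
  rw [← h2, ← inner_add_left]
  congr 1
  simp only [Φ] at h
  rw [← h]
  abel

end AlongMap

/-! ### Traces, and smoothness of the iterated Laplacians of the tension field. -/

section AlongMap

variable {E : Type*} [NormedAddCommGroup E] [NormedSpace ℝ E] [FiniteDimensional ℝ E]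
  {M : Type*} [TopologicalSpace M] [ChartedSpace E M] [IsManifold 𝓘(ℝ, E) ∞ M]
  [RiemannianBundle (fun x : M => TangentSpace 𝓘(ℝ, E) x)]
  {F : Type*} [NormedAddCommGroup F] [NormedSpace ℝ F] [FiniteDimensional ℝ F]
  {N : Type*} [TopologicalSpace N] [ChartedSpace F N] [IsManifold 𝓘(ℝ, F) ∞ N]
  [RiemannianBundle (fun y : N => TangentSpace 𝓘(ℝ, F) y)]

section Trace

variable [IsContMDiffRiemannianBundle 𝓘(ℝ, E) ∞ E (fun x : M => TangentSpace 𝓘(ℝ, E) x)]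

/-- The vector fields near `x` dual to the coordinate frame extending `frame x`. -/
def dualFrame (x : M) (i : Fin (Module.finrank ℝ (TangentSpace 𝓘(ℝ, E) x))) (y : M) :
    TangentSpace 𝓘(ℝ, E) y :=
  sharp (frameCoeff x i y)

theorem smoothFieldAt_dualFrame (x : M) (i : Fin (Module.finrank ℝ (TangentSpace 𝓘(ℝ, E) x))) :
    SmoothFieldAt (dualFrame x i) x := by
  refine smoothFieldAt_of_inner fun v => ?_
  refine ((smoothFieldAt_constExt v).frameCoeff (mem_tangentTriv_baseSet x) i).congr_of_eventuallyEq
    ?_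
  filter_upwards [eventually_mem_tangentTriv_baseSet (E := E) x] with y hy
  exact inner_sharp (isLinearMap_frameCoeff hy i) _

/-- The bases `frame E y` are chosen independently at each `y` and need not vary continuously.
Expanding the second slot in the coordinate frame and collecting coefficients in the first yields
the dual frame, so the trace is expressed through fields smooth near `x`. -/
theorem sum_frame_eq_sum_dualFrame {A : Type*} [AddCommGroup A] [Module ℝ A] {x y : M}
    (hy : y ∈ (tangentTriv E x).baseSet)
    {H : TangentSpace 𝓘(ℝ, E) y → (Π z : M, TangentSpace 𝓘(ℝ, E) z) → A}
    (hH : ∀ W, SmoothFieldAt W y → IsLinearMap ℝ (fun v => H v W))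
    (hH' : ∀ v, TensorialAlongAt (E := E) (fun z : M => z) (H v) y) :
    ∑ j, H (frame E y j) (constExt (frame E y j))
      = ∑ i, H (dualFrame x i y) (constExt (frame E x i)) := by
  have hs (i) := smoothFieldAt_constExt_of_mem hy (frame E x i)
  have h1 (j) : H (frame E y j) (constExt (frame E y j))
      = ∑ i, frameCoeff x i y (frame E y j) • H (frame E y j) (constExt (frame E x i)) := by
    have hc (i) : SmoothFieldAt (fun z => frameCoeff x i y (frame E y j) •
        constExt (frame E x i) z) y :=
      SmoothAlongAt.smul (φ := fun z : M => z) (f := fun _ => frameCoeff x i y (frame E y j))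
        contMDiffAt_const (hs i)
    rw [(hH' _).pointwise (W := fun z => ∑ i, frameCoeff x i y (frame E y j) •
      constExt (frame E x i) z) (smoothFieldAt_constExt _)
      (smoothAlongAt_sum (φ := fun z : M => z) contMDiffAt_id _ fun i _ => hc i)
      (by rw [constExt_self, sum_frameCoeff_smul hy]),
      (hH' _).sum contMDiffAt_id _ fun i _ => hc i]
    exact Finset.sum_congr rfl fun i _ => (hH' _).smul
      (f := fun _ => frameCoeff x i y (frame E y j)) contMDiffAt_const (hs i)
  simp only [h1]
  rw [Finset.sum_comm]
  refine Finset.sum_congr rfl fun i _ => ?_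
  have h2 := map_sum ((hH _ (hs i)).mk' _)
    (fun j => frameCoeff x i y (frame E y j) • frame E y j) Finset.univ
  simp only [IsLinearMap.mk'_apply, (hH _ (hs i)).map_smul] at h2
  exact h2.symm

variable [IsContMDiffRiemannianBundle 𝓘(ℝ, F) ∞ F (fun y : N => TangentSpace 𝓘(ℝ, F) y)]
  {φ : M → N}

variable (φ) in
/-- The trace of the covariant derivative of a one-form on `M` with values in `φ^* TN`. -/
def traceCov (L : Π y : M, TangentSpace 𝓘(ℝ, E) y → TangentSpace 𝓘(ℝ, F) (φ y)) (x : M) :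
    TangentSpace 𝓘(ℝ, F) (φ x) :=
  ∑ j, (covAlong E F φ (fun y => L y (constExt (frame E x j) y)) x (frame E x j)
    - L x (nabla (constExt (frame E x j)) x (frame E x j)))

/-- Serves both operators at once: `L` = dφ gives the tension field and `L` = ∇̄V gives minus the
rough Laplacian. -/
theorem smoothAlongAt_traceCov (hφ : ContMDiff 𝓘(ℝ, E) 𝓘(ℝ, F) ∞ φ)
    {L : Π y : M, TangentSpace 𝓘(ℝ, E) y → TangentSpace 𝓘(ℝ, F) (φ y)}
    (hL : ∀ y, IsLinearMap ℝ (L y))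
    (hL' : ∀ (y : M) (W : Π z : M, TangentSpace 𝓘(ℝ, E) z), SmoothFieldAt W y →
      SmoothAlongAt (E := E) φ (fun z => L z (W z)) y) (x : M) :
    SmoothAlongAt (E := E) φ (traceCov φ L) x := by
  have h : SmoothAlongAt (E := E) φ (fun y => ∑ i,
      (covAlong E F φ (fun z => L z (constExt (frame E x i) z)) y (dualFrame x i y)
        - L y (nabla (constExt (frame E x i)) y (dualFrame x i y)))) x := by
    refine smoothAlongAt_sum hφ.contMDiffAt _ fun i _ => ?_
    refine (SmoothAlongAt.covAlong hφ ?_ (smoothFieldAt_dualFrame x i)).sub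
      (hL' _ _ ((smoothFieldAt_constExt _).nabla (smoothFieldAt_dualFrame x i)))
    filter_upwards [eventually_mem_tangentTriv_baseSet (E := E) x] with y hy
    exact hL' _ _ (smoothFieldAt_constExt_of_mem hy _)
  refine h.congr ?_
  filter_upwards [eventually_mem_tangentTriv_baseSet (E := E) x] with y hy
  -- This is (∇_v L)(W); the two Leibniz terms cancel, so it is tensorial in `W`.
  let H : TangentSpace 𝓘(ℝ, E) y → (Π z : M, TangentSpace 𝓘(ℝ, E) z) →
      TangentSpace 𝓘(ℝ, F) (φ y) := fun v W =>
    covAlong E F φ (fun z => L z (W z)) y v - L y (nabla W y v)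
  refine sum_frame_eq_sum_dualFrame (H := H) hy ?_ ?_
  · intro W hW
    have h1 := isLinearMap_covAlong (E := E) (F := F) φ (fun z => L z (W z)) y
    have h2 := isLinearMap_nabla hW.diff
    constructor
    · intro u v
      simp only [H, h1.map_add, h2.map_add, (hL y).map_add]
      abel
    · intro c v
      simp only [H, h1.map_smul, h2.map_smul, (hL y).map_smul, smul_sub]
  · intro v
    constructor
    · intro W W' hW hW'
      have h1 : nabla (fun z => W z + W' z) y v = nabla W y v + nabla W' y v :=
        nabla_add (SmoothFieldAt.diff hW) (SmoothFieldAt.diff hW') v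
      simp only [H, (hL _).map_add]
      rw [covAlong_add (hL' _ _ hW) (hL' _ _ hW'), h1, (hL _).map_add]
      abel
    · intro f W hf hW
      have h1 : nabla (fun z => f z • W z) y v
          = f y • nabla W y v + mvfderiv 𝓘(ℝ, E) f y v • W y :=
        nabla_smul (hf.mdifferentiableAt (by simp)) (SmoothFieldAt.diff hW) v
      simp only [H, (hL _).map_smul]
      rw [covAlong_smul hf (hL' _ _ hW), h1, (hL _).map_add, (hL _).map_smul, (hL _).map_smul,
        smul_sub]
      abel
    · intro W W' h1
      have h2 : nabla W y v = nabla W' y v := nabla_congr h1 v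
      simp only [H]
      rw [h2, covAlong_congr (V := fun z => L z (W z)) (W := fun z => L z (W' z))
        (h1.mono fun z hz => by rw [hz])]

theorem smoothAlongAt_tension (hφ : ContMDiff 𝓘(ℝ, E) 𝓘(ℝ, F) ∞ φ) (x : M) :
    SmoothAlongAt (E := E) φ (tension E F φ) x :=
  smoothAlongAt_traceCov hφ (isLinearMap_dmap φ) (fun _ _ hW => smoothAlongAt_dmap hφ hW) x

theorem smoothAlongAt_roughLaplacian (hφ : ContMDiff 𝓘(ℝ, E) 𝓘(ℝ, F) ∞ φ)
    {V : Π y : M, TangentSpace 𝓘(ℝ, F) (φ y)} (hV : ∀ x, SmoothAlongAt (E := E) φ V x) (x : M) :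
    SmoothAlongAt (E := E) φ (roughLaplacian E F φ V) x :=
  (smoothAlongAt_traceCov hφ (isLinearMap_covAlong φ V)
    (fun _ _ hW => SmoothAlongAt.covAlong hφ (Eventually.of_forall hV) hW) x).neg

theorem smoothAlongAt_lapTension (hφ : ContMDiff 𝓘(ℝ, E) 𝓘(ℝ, F) ∞ φ) (k : ℕ) (x : M) :
    SmoothAlongAt (E := E) φ (lapTension E F φ k) x := by
  induction k generalizing x with
  | zero => exact smoothAlongAt_tension hφ x
  | succ k ih =>
    simp only [lapTension, Function.iterate_succ_apply']
    exact smoothAlongAt_roughLaplacian hφ ih x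

theorem lapTension_succ (k : ℕ) :
    lapTension E F φ (k + 1) = roughLaplacian E F φ (lapTension E F φ k) := by
  simp only [lapTension, Function.iterate_succ_apply']

end Trace

/-! ### Divergence of one-forms. -/

section OneForms

variable [IsContMDiffRiemannianBundle 𝓘(ℝ, E) ∞ E (fun x : M => TangentSpace 𝓘(ℝ, E) x)]
  {x : M} {α β : Π y : M, TangentSpace 𝓘(ℝ, E) y → ℝ}

/-- Smoothness of a one-form at a point, tested on smooth vector fields. -/
def SmoothFormAt (α : Π y : M, TangentSpace 𝓘(ℝ, E) y → ℝ) (x : M) : Prop :=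
  ∀ W : Π y : M, TangentSpace 𝓘(ℝ, E) y, SmoothFieldAt W x →
    ContMDiffAt 𝓘(ℝ, E) 𝓘(ℝ) ∞ (fun y => α y (W y)) x

/-- The divergence `∑ⱼ (∇_{eⱼ} α)(eⱼ)` of a one-form. -/
def divForm (α : Π y : M, TangentSpace 𝓘(ℝ, E) y → ℝ) (x : M) : ℝ :=
  ∑ j, (mvfderiv 𝓘(ℝ, E) (fun y => α y (constExt (frame E x j) y)) x (frame E x j)
    - α x (nabla (constExt (frame E x j)) x (frame E x j)))

theorem SmoothFormAt.add (hα : SmoothFormAt α x) (hβ : SmoothFormAt β x) :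
    SmoothFormAt (fun y v => α y v + β y v) x := fun W hW => (hα W hW).add (hβ W hW)

theorem SmoothFormAt.neg (hα : SmoothFormAt α x) : SmoothFormAt (fun y v => -α y v) x :=
  fun W hW => (hα W hW).neg

theorem smoothFormAt_sum {ι : Type*} {s : Finset ι}
    {α : ι → Π y : M, TangentSpace 𝓘(ℝ, E) y → ℝ} (hα : ∀ i ∈ s, SmoothFormAt (α i) x) :
    SmoothFormAt (fun y v => ∑ i ∈ s, α i y v) x :=
  fun W hW => ContMDiffAt.sum fun i hi => hα i hi W hW

theorem divForm_add (hα : SmoothFormAt α x) (hβ : SmoothFormAt β x) :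
    divForm (fun y v => α y v + β y v) x = divForm α x + divForm β x := by
  simp only [divForm, ← Finset.sum_add_distrib]
  refine Finset.sum_congr rfl fun j _ => ?_
  have hj := smoothFieldAt_constExt (frame E x j)
  rw [mvfderiv_fun_add ((hα _ hj).mdifferentiableAt (by simp))
    ((hβ _ hj).mdifferentiableAt (by simp)), _root_.add_apply]
  ring

theorem divForm_neg : divForm (fun y v => -α y v) x = -divForm α x := by
  simp only [divForm, ← Finset.sum_neg_distrib]
  refine Finset.sum_congr rfl fun j _ => ?_
  rw [mvfderiv_fun_neg, _root_.neg_apply]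
  ring

theorem divForm_zero : divForm (fun (y : M) (_ : TangentSpace 𝓘(ℝ, E) y) => (0 : ℝ)) x = 0 := by
  simp [divForm, mvfderiv_const]

theorem divForm_sum {ι : Type*} {s : Finset ι} {α : ι → Π y : M, TangentSpace 𝓘(ℝ, E) y → ℝ}
    (hα : ∀ i ∈ s, SmoothFormAt (α i) x) :
    divForm (fun y v => ∑ i ∈ s, α i y v) x = ∑ i ∈ s, divForm (α i) x := by
  classical
  induction s using Finset.induction_on with
  | empty => simpa using divForm_zero
  | insert i s hi ih =>
    simp only [Finset.sum_insert hi]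
    rw [divForm_add (hα i (Finset.mem_insert_self _ _)) (smoothFormAt_sum fun j hj =>
      hα j (Finset.mem_insert_of_mem hj)), ih fun j hj => hα j (Finset.mem_insert_of_mem hj)]

theorem smoothFieldAt_sharp (hα : SmoothFormAt α x) (hl : ∀ y, IsLinearMap ℝ (α y)) :
    SmoothFieldAt (fun y => sharp (α y)) x := by
  refine smoothFieldAt_of_inner fun v => ?_
  simpa only [inner_sharp (hl _)] using hα _ (smoothFieldAt_constExt v)

/-- By metric compatibility, ⟨∇_v α^♯, W⟩ = v(α(W)) - α(∇_v W). -/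
theorem divergence_sharp (hα : SmoothFormAt α x) (hl : ∀ y, IsLinearMap ℝ (α y)) :
    divergence (fun y => sharp (α y)) x = divForm α x := by
  refine Finset.sum_congr rfl fun j _ => ?_
  have h := mvfderiv_inner (smoothFieldAt_sharp hα hl).diff
    (diffFieldAt_constExt (frame E x j)) (frame E x j)
  simp only [inner_sharp (hl _), constExt_self] at h
  linarith

end OneForms

end AlongMap

/-! ### The divergence of the current. -/

section AlongMap

variable {E : Type*} [NormedAddCommGroup E] [NormedSpace ℝ E] [FiniteDimensional ℝ E]
  {M : Type*} [TopologicalSpace M] [ChartedSpace E M] [IsManifold 𝓘(ℝ, E) ∞ M]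
  [RiemannianBundle (fun x : M => TangentSpace 𝓘(ℝ, E) x)]
  {F : Type*} [NormedAddCommGroup F] [NormedSpace ℝ F] [FiniteDimensional ℝ F]
  {N : Type*} [TopologicalSpace N] [ChartedSpace F N] [IsManifold 𝓘(ℝ, F) ∞ N]
  [RiemannianBundle (fun y : N => TangentSpace 𝓘(ℝ, F) y)]

variable [IsContMDiffRiemannianBundle 𝓘(ℝ, E) ∞ E (fun x : M => TangentSpace 𝓘(ℝ, E) x)]
  [IsContMDiffRiemannianBundle 𝓘(ℝ, F) ∞ F (fun y : N => TangentSpace 𝓘(ℝ, F) y)]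
  {φ : M → N} {A B : Π y : M, TangentSpace 𝓘(ℝ, F) (φ y)} {X : Π y : N, TangentSpace 𝓘(ℝ, F) y}

variable (E) in
/-- The one-form `v ↦ ⟨∇̄_v A, B⟩`. -/
def pairForm (φ : M → N) (A B : Π y : M, TangentSpace 𝓘(ℝ, F) (φ y)) (y : M)
    (v : TangentSpace 𝓘(ℝ, E) y) : ℝ :=
  inner ℝ (covAlong E F φ A y v) (B y)

theorem isLinearMap_pairForm (A B : Π y : M, TangentSpace 𝓘(ℝ, F) (φ y)) (y : M) :
    IsLinearMap ℝ (pairForm E φ A B y) := by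
  have h := isLinearMap_covAlong (E := E) (F := F) φ A y
  constructor
  · intro u v
    simp only [pairForm, h.map_add, inner_add_left]
  · intro c v
    simp only [pairForm, h.map_smul, inner_smul_left, conj_trivial, smul_eq_mul]

theorem smoothFormAt_pairForm (hφ : ContMDiff 𝓘(ℝ, E) 𝓘(ℝ, F) ∞ φ)
    (hA : ∀ x, SmoothAlongAt (E := E) φ A x) (hB : ∀ x, SmoothAlongAt (E := E) φ B x) (x : M) :
    SmoothFormAt (pairForm E φ A B) x := fun _ hW =>
  (SmoothAlongAt.covAlong hφ (Eventually.of_forall hA) hW).inner (hB x)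

/-- The product rule under the trace. The gradient product is symmetric in `A` and `B`, so it
disappears from the difference of the forms for (A, B) and (B, A). -/
theorem divForm_pairForm (hφ : ContMDiff 𝓘(ℝ, E) 𝓘(ℝ, F) ∞ φ)
    (hA : ∀ x, SmoothAlongAt (E := E) φ A x) (hB : ∀ x, SmoothAlongAt (E := E) φ B x) (x : M) :
    divForm (pairForm E φ A B) x = -inner ℝ (roughLaplacian E F φ A x) (B x)
      + ∑ j, inner ℝ (covAlong E F φ A x (frame E x j)) (covAlong E F φ B x (frame E x j)) := by
  rw [roughLaplacian, inner_neg_left, neg_neg, sum_inner, ← Finset.sum_add_distrib]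
  refine Finset.sum_congr rfl fun j _ => ?_
  have hj := smoothFieldAt_constExt (frame E x j)
  have h := mvfderiv_inner_along (SmoothAlongAt.covAlong hφ (Eventually.of_forall hA) hj) (hB x)
    (frame E x j)
  simp only [constExt_self] at h
  simp only [pairForm, inner_sub_left]
  rw [h]
  ring

theorem SmoothAlongAt.comp_killing (hφ : ContMDiff 𝓘(ℝ, E) 𝓘(ℝ, F) ∞ φ) (hX : IsKilling X)
    (x : M) : SmoothAlongAt (E := E) φ (fun y => X (φ y)) x :=
  SmoothFieldAt.comp (hX.1 (φ x)) hφ.contMDiffAt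

/-- Since ∇̄(X∘φ) = ∇X(dφ), a second derivative hits either dφ, whose trace is the tension field, or
∇X, which Kostant's identity turns into curvature. -/
theorem inner_roughLaplacian_killing (hφ : ContMDiff 𝓘(ℝ, E) 𝓘(ℝ, F) ∞ φ) (hX : IsKilling X)
    (x : M) (w : TangentSpace 𝓘(ℝ, F) (φ x)) :
    inner ℝ (roughLaplacian E F φ (fun y => X (φ y)) x) w
      = -inner ℝ (nabla X (φ x) (tension E F φ x)) w
        - ∑ j, inner ℝ (curvature (dmap E F φ x (frame E x j)) w (dmap E F φ x (frame E x j)))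
          (X (φ x)) := by
  have hXs (z : N) : SmoothFieldAt X z := hX.1 z
  have h0 (y : M) (v : TangentSpace 𝓘(ℝ, E) y) :
      covAlong E F φ (fun y => X (φ y)) y v = nabla X (φ y) (dmap E F φ y v) :=
    covAlong_comp hφ.contMDiffAt (hXs _) v
  have hK := isLinearMap_nabla (hXs (φ x)).diff
  have h1 := map_sum (hK.mk' _) (fun j =>
    covAlong E F φ (fun y => dmap E F φ y (constExt (frame E x j) y)) x (frame E x j)
    - dmap E F φ x (nabla (constExt (frame E x j)) x (frame E x j))) Finset.univ
  simp only [IsLinearMap.mk'_apply, hK.map_sub] at h1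
  simp only [roughLaplacian, tension, h0]
  rw [h1, inner_neg_left, sum_inner, sum_inner, ← neg_add', ← Finset.sum_add_distrib]
  refine congrArg _ (Finset.sum_congr rfl fun j _ => ?_)
  have hj := smoothFieldAt_constExt (frame E x j)
  have h2 := inner_covAlong_nabla_killing hX (smoothAlongAt_dmap hφ hj) (frame E x j) w
  simp only [constExt_self] at h2
  rw [inner_sub_left, inner_sub_left, h2]
  ring

theorem smoothAlongAt_nabla_killing (hX : IsKilling X) (hA : ∀ x, SmoothAlongAt (E := E) φ A x)
    (x : M) : SmoothAlongAt (E := E) φ (fun y => nabla X (φ y) (A y)) x :=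
  SmoothAlongAt.nabla (hX.1 (φ x)) (hA x)

/-- The divergence of the summands of the current containing the derivative of `X`. -/
theorem divForm_pairForm_nabla_killing (hφ : ContMDiff 𝓘(ℝ, E) 𝓘(ℝ, F) ∞ φ) (hX : IsKilling X)
    (hA : ∀ x, SmoothAlongAt (E := E) φ A x) (hB : ∀ x, SmoothAlongAt (E := E) φ B x) (x : M) :
    divForm (pairForm E φ A (fun y => nabla X (φ y) (B y))) x
        + divForm (pairForm E φ B (fun y => nabla X (φ y) (A y))) x
      = -inner ℝ (roughLaplacian E F φ A x) (nabla X (φ x) (B x))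
        + inner ℝ (A x) (nabla X (φ x) (roughLaplacian E F φ B x))
        - ∑ j, inner ℝ (curvature (covAlong E F φ A x (frame E x j)) (B x)
              (dmap E F φ x (frame E x j))
            - curvature (A x) (covAlong E F φ B x (frame E x j)) (dmap E F φ x (frame E x j)))
          (X (φ x)) := by
  rw [divForm_pairForm hφ hA (smoothAlongAt_nabla_killing hX hB),
    divForm_pairForm hφ hB (smoothAlongAt_nabla_killing hX hA)]
  -- The products ⟨∇̄A, ∇X(∇̄B)⟩ and ⟨∇̄B, ∇X(∇̄A)⟩ cancel by skewness of ∇X; only the curvature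
  -- from Kostant's identity remains.
  have h (j) : inner ℝ (covAlong E F φ A x (frame E x j))
        (covAlong E F φ (fun y => nabla X (φ y) (B y)) x (frame E x j))
      + inner ℝ (covAlong E F φ B x (frame E x j))
        (covAlong E F φ (fun y => nabla X (φ y) (A y)) x (frame E x j))
      = -inner ℝ (curvature (covAlong E F φ A x (frame E x j)) (B x)
              (dmap E F φ x (frame E x j))
            - curvature (A x) (covAlong E F φ B x (frame E x j)) (dmap E F φ x (frame E x j)))
          (X (φ x)) := by
    rw [real_inner_comm, real_inner_comm _ (covAlong E F φ B x (frame E x j)),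
      inner_covAlong_nabla_killing hX (hB x), inner_covAlong_nabla_killing hX (hA x),
      inner_nabla_killing hX, curvature_swap (covAlong E F φ A x (frame E x j)),
      inner_sub_left, inner_neg_left, real_inner_comm (covAlong E F φ B x (frame E x j))]
    ring
  have hs := Finset.sum_congr rfl fun j (_ : j ∈ Finset.univ) => h j
  rw [Finset.sum_add_distrib, Finset.sum_neg_distrib] at hs
  have h1 := inner_nabla_killing hX (A x) (roughLaplacian E F φ B x)
  rw [real_inner_comm] at h1
  linarith

/-- A telescoping sum for an antisymmetric array. -/
theorem sum_telescope {t : ℕ → ℕ → ℝ} (ht : ∀ i j, t i j = -t j i) {n m : ℕ} (hm : m ≤ n) :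
    ∑ l ∈ Finset.Icc 1 m, (t (n + l) (n - l) - t (n + l - 1) (n + 1 - l)) = t (n + m) (n - m) := by
  induction m with
  | zero =>
    simp only [zero_lt_one, Finset.Icc_eq_empty_of_lt, Finset.sum_empty, add_zero, tsub_zero]
    -- The lower end of the telescope, t(n,n), vanishes by antisymmetry.
    linarith [ht n n]
  | succ m ih =>
    rw [Finset.sum_Icc_succ_top (by omega), ih (by omega)]
    rw [show n + (m + 1) - 1 = n + m by omega, show n + 1 - (m + 1) = n - m by omega]
    ring

/-- Skewness of ∇X moves it onto the undifferentiated factor, so every term becomes a `pairForm`. -/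
theorem currentFormEven_eq (hX : IsKilling X) (n : ℕ) :
    currentFormEven E F (n + 1) φ X = fun y v =>
      pairForm E φ (lapTension E F φ (2 * n)) (fun y => X (φ y)) y v
        + -pairForm E φ (fun y => X (φ y)) (lapTension E F φ (2 * n)) y v
        + ∑ l ∈ Finset.Icc 1 n, -(
          pairForm E φ (lapTension E F φ (n + l - 1))
            (fun y => nabla X (φ y) (lapTension E F φ (n - l) y)) y v
          + pairForm E φ (lapTension E F φ (n - l))
            (fun y => nabla X (φ y) (lapTension E F φ (n + l - 1) y)) y v) := by
  funext y v
  simp only [currentFormEven, pairForm, inner_nabla_killing hX, sub_eq_add_neg, neg_add,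
    Nat.add_sub_cancel]
  refine congrArg _ (Finset.sum_congr rfl fun l _ => ?_)
  rw [show n + 1 + l - 2 = n + l - 1 by omega, show n + 1 - l - 1 = n - l by omega]

theorem isLinearMap_currentFormEven (hX : IsKilling X) (n : ℕ) (y : M) :
    IsLinearMap ℝ (currentFormEven E F (n + 1) φ X y) := by
  rw [currentFormEven_eq hX]
  have h (A B : Π y : M, TangentSpace 𝓘(ℝ, F) (φ y)) := isLinearMap_pairForm (E := E) A B y
  constructor
  · intro u v
    simp only [(h _ _).map_add]
    simp only [neg_add, Finset.sum_add_distrib]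
    ring
  · intro c v
    simp only [(h _ _).map_smul, smul_eq_mul, mul_add, Finset.mul_sum, mul_neg]

theorem smoothFormAt_currentFormEven (hφ : ContMDiff 𝓘(ℝ, E) 𝓘(ℝ, F) ∞ φ) (hX : IsKilling X)
    (n : ℕ) (x : M) :
    SmoothFormAt (currentFormEven E F (n + 1) φ X) x := by
  have hσ := smoothAlongAt_lapTension hφ
  have hXφ := SmoothAlongAt.comp_killing hφ hX
  rw [currentFormEven_eq hX]
  refine ((smoothFormAt_pairForm hφ (hσ _) hXφ x).add
    (smoothFormAt_pairForm hφ hXφ (hσ _) x).neg).add (smoothFormAt_sum fun l _ => ?_)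
  exact ((smoothFormAt_pairForm hφ (hσ _) (smoothAlongAt_nabla_killing hX (hσ _)) x).add
    (smoothFormAt_pairForm hφ (hσ _) (smoothAlongAt_nabla_killing hX (hσ _)) x)).neg

theorem divForm_currentFormEven (hφ : ContMDiff 𝓘(ℝ, E) 𝓘(ℝ, F) ∞ φ) (hX : IsKilling X)
    (n : ℕ) (x : M) :
    divForm (currentFormEven E F (n + 1) φ X) x
      = -inner ℝ (tauEven E F (n + 1) φ x) (X (φ x)) := by
  have hσ := smoothAlongAt_lapTension hφ
  have hXφ := SmoothAlongAt.comp_killing hφ hX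
  have h1 := smoothFormAt_pairForm hφ (hσ (2 * n)) hXφ x
  have h2 := smoothFormAt_pairForm hφ hXφ (hσ (2 * n)) x
  have h3 (k m) := smoothFormAt_pairForm hφ (hσ k) (smoothAlongAt_nabla_killing hX (hσ m)) x
  have h4 (l) := (h3 (n + l - 1) (n - l)).add (h3 (n - l) (n + l - 1))
  let t : ℕ → ℕ → ℝ := fun i j =>
    inner ℝ (lapTension E F φ i x) (nabla X (φ x) (lapTension E F φ j x))
  have ht (i j) : t i j = -t j i := by
    simp only [t]
    rw [real_inner_comm, inner_nabla_killing hX]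
  have h5 : ∀ l ∈ Finset.Icc 1 n, divForm (fun y v => -(
          pairForm E φ (lapTension E F φ (n + l - 1))
            (fun y => nabla X (φ y) (lapTension E F φ (n - l) y)) y v
          + pairForm E φ (lapTension E F φ (n - l))
            (fun y => nabla X (φ y) (lapTension E F φ (n + l - 1) y)) y v)) x
      = (t (n + l) (n - l) - t (n + l - 1) (n + 1 - l))
        + inner ℝ (∑ j, (curvature (covAlong E F φ (lapTension E F φ (n + l - 1)) x (frame E x j))
            (lapTension E F φ (n - l) x) (dmap E F φ x (frame E x j))
          - curvature (lapTension E F φ (n + l - 1) x)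
            (covAlong E F φ (lapTension E F φ (n - l)) x (frame E x j))
            (dmap E F φ x (frame E x j)))) (X (φ x)) := by
    intro l hl
    -- Both bounds matter: `n + l - 1 + 1 = n + l` needs 1 ≤ l, and `n - l + 1 = n + 1 - l` needs l
    -- ≤ n.
    obtain ⟨hl1, hl2⟩ := Finset.mem_Icc.1 hl
    rw [divForm_neg, divForm_add (h3 _ _) (h3 _ _),
      divForm_pairForm_nabla_killing hφ hX (hσ _) (hσ _), ← lapTension_succ, ← lapTension_succ,
      sum_inner, show n + l - 1 + 1 = n + l by omega, show n - l + 1 = n + 1 - l by omega]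
    ring
  have h6 := inner_roughLaplacian_killing hφ hX x (lapTension E F φ (2 * n) x)
  have h7 (v w : TangentSpace 𝓘(ℝ, F) (φ x)) : inner ℝ (curvature w v w) (X (φ x))
      = -inner ℝ (curvature v w w) (X (φ x)) := by
    rw [curvature_swap v w, inner_neg_left]
  -- The upper end of the telescope is exactly the term in ∇_τ X that `h6` contributes with the
  -- opposite sign.
  have h8 : t (n + n) (n - n)
      = inner ℝ (nabla X (φ x) (tension E F φ x)) (lapTension E F φ (2 * n) x) := by
    simp only [t, Nat.sub_self, ← two_mul]
    exact real_inner_comm _ _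
  -- Brings the gradient products of the first two forms to a common order so that they cancel.
  have h9 (j) := real_inner_comm (covAlong E F φ (lapTension E F φ (2 * n)) x (frame E x j))
    (covAlong E F φ (fun y => X (φ y)) x (frame E x j))
  have h10 : tauEven E F (n + 1) φ x = lapTension E F φ (2 * n + 1) x
    - ∑ j, curvature (lapTension E F φ (2 * n) x) (dmap E F φ x (frame E x j))
        (dmap E F φ x (frame E x j))
    - ∑ l ∈ Finset.Icc 1 n, ∑ j,
        (curvature (covAlong E F φ (lapTension E F φ (n + l - 1)) x (frame E x j))
            (lapTension E F φ (n - l) x) (dmap E F φ x (frame E x j))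
          - curvature (lapTension E F φ (n + l - 1) x)
            (covAlong E F φ (lapTension E F φ (n - l)) x (frame E x j))
            (dmap E F φ x (frame E x j))) := by
    have h (l : ℕ) : n + 1 + l - 2 = n + l - 1 ∧ n + 1 - l - 1 = n - l := by omega
    rw [tauEven]
    simp only [(h _).1, (h _).2, Nat.add_sub_cancel]
    rfl
  rw [currentFormEven_eq hX, divForm_add (h1.add h2.neg) (smoothFormAt_sum fun l _ => (h4 l).neg),
    divForm_add h1 h2.neg, divForm_neg, divForm_sum fun l _ => (h4 l).neg,
    Finset.sum_congr rfl h5, Finset.sum_add_distrib, sum_telescope ht le_rfl, ← sum_inner,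
    divForm_pairForm hφ (hσ _) hXφ, divForm_pairForm hφ hXφ (hσ _), h6, h8, h10, ← lapTension_succ]
  simp only [h7, h9, inner_sub_left, sum_inner, Finset.sum_neg_distrib]
  ring

end AlongMap

end PolyharmonicMaps

end

theorem mainTheorem1
    {E : Type*} [NormedAddCommGroup E] [NormedSpace ℝ E] [FiniteDimensional ℝ E]
    {M : Type*} [TopologicalSpace M] [ChartedSpace E M] [IsManifold 𝓘(ℝ, E) ∞ M]
    [RiemannianBundle (fun x : M => TangentSpace 𝓘(ℝ, E) x)]
    [IsContMDiffRiemannianBundle 𝓘(ℝ, E) ∞ E (fun x : M => TangentSpace 𝓘(ℝ, E) x)]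
    {F : Type*} [NormedAddCommGroup F] [NormedSpace ℝ F] [FiniteDimensional ℝ F]
    {N : Type*} [TopologicalSpace N] [ChartedSpace F N] [IsManifold 𝓘(ℝ, F) ∞ N]
    [RiemannianBundle (fun y : N => TangentSpace 𝓘(ℝ, F) y)]
    [IsContMDiffRiemannianBundle 𝓘(ℝ, F) ∞ F (fun y : N => TangentSpace 𝓘(ℝ, F) y)]
    (s : ℕ) (hs : 1 ≤ s)
    (φ : M → N) (hφ : ContMDiff 𝓘(ℝ, E) 𝓘(ℝ, F) ∞ φ)
    (X : Π y : N, TangentSpace 𝓘(ℝ, F) y) (hX : PolyharmonicMaps.IsKilling X) :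
    PolyharmonicMaps.IsSmoothField (PolyharmonicMaps.currentEven E F s φ X) ∧
      (∀ x : M,
        PolyharmonicMaps.divergence (PolyharmonicMaps.currentEven E F s φ X) x
          = -inner ℝ (PolyharmonicMaps.tauEven E F s φ x) (X (φ x))) ∧
      (PolyharmonicMaps.IsPolyharmonicEven E F s φ →
        ∀ x : M, PolyharmonicMaps.divergence (PolyharmonicMaps.currentEven E F s φ X) x = 0) := by
  -- With s = n + 1 the indices s+ℓ-2 and s-ℓ-1 become n+ℓ-1 and n-ℓ, which involve no truncation
  -- for 1 ≤ ℓ ≤ n.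
  obtain ⟨n, rfl⟩ : ∃ n, s = n + 1 := ⟨s - 1, by omega⟩
  have hs := PolyharmonicMaps.smoothFormAt_currentFormEven hφ hX n
  have hl := PolyharmonicMaps.isLinearMap_currentFormEven (E := E) (φ := φ) hX n
  have hd (x : M) : PolyharmonicMaps.divergence (PolyharmonicMaps.currentEven E F (n + 1) φ X) x
      = -inner ℝ (PolyharmonicMaps.tauEven E F (n + 1) φ x) (X (φ x)) :=
    (PolyharmonicMaps.divergence_sharp (hs x) hl).trans
      (PolyharmonicMaps.divForm_currentFormEven hφ hX n x)
  refine ⟨fun x => PolyharmonicMaps.smoothFieldAt_sharp (hs x) hl, hd, fun h x => ?_⟩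
  rw [hd, h x, inner_zero_left, neg_zero]
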